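/- Let $K$ be a compact, simply connected, simple Lie group (that is, its Lie algebra $\mathfrak k$ is simple), and let $G=K^c$ be its complexification: the simply connected complex Lie group that contains $K$ as a Lie subgroup and whose complex Lie algebra is $\mathfrak g=\mathfrak k^c=\mathfrak k\otimes_{\mathbb R}\mathbb C=\mathfrak k\oplus i\mathfrak k$. Let $\theta(X+iY)=X-iY$ for $X,Y\in\mathfrak k$, so that the Cartan decomposition of the real Lie algebra $\mathfrak g$ is $\mathfrak g=\mathfrak k\oplus\mathfrak p$ with $\mathfrak p=i\mathfrak k$, and $G/K$ is a symmetric space of type IV. Roots are taken with respect to Cartan subalgebras $\mathfrak h$ of the complex Lie algebra $\mathfrak g$ that are complexifications of maximal abelian subalgebras of $\mathfrak k$ (equivalently, $\theta(\mathfrak h)=\mathfrak h$), and the maximal root is the largest root for an ordering of the roots. Then there is exactly one real multiple $B'$ of the (complex) Killing form of $\mathfrak k^c$ for which a maximal root $\mu$ has length $\sqrt2$, i.e. $B'(H_\mu,H_\mu)=2$, where $H_\mu\in\mathfrak h$ is defined by $B'(H_\mu,h)=\mu(h)$ for all $h\in\mathfrak h$; it does not depend on $\mathfrak h$ and the ordering.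 It is called the renormalized Killing form. The form $\langle X,Y\rangle=-\operatorname{Re}B'(X,\theta Y)$ is a real inner product on $\mathfrak g$ (it is $-B'$ on $\mathfrak k$, it is $B'$ on $\mathfrak p$, and $\mathfrak k\perp\mathfrak p$), and so it defines a left-invariant Riemannian metric on $G$. Write $\|X\|=\langle X,X\rangle^{1/2}$, $N(f)=\sup\{\|f(X)\| : X\in\mathfrak g,\ \|X\|=1\}$ for $f:\mathfrak g\to\mathfrak g$, and $$C_1=\sup\{N(\operatorname{ad}X) : X\in\mathfrak p,\ \|X\|=1\},\qquad C_2=\sup\{N(\operatorname{ad}X) : X\in\mathfrak k,\ \|X\|=1\}.$$ Then $$C_1=C_2=\sqrt2 .$$ Moreover both suprema are attained as follows. Let $\mathfrak h$ be as above, let $\mu$ be a maximal root, and let $X_\mu$, $X_{-\mu}$ be the corresponding root vectors of a Weyl–Chevalley basis adapted to $\theta$, that is, $X_{\pm\mu}$ lies in the root space of $\pm\mu$, $[X_\mu,X_{-\mu}]=H_\mu$ and $\theta X_\mu=-X_{-\mu}$ (such vectors exist). Put $H=\frac1{\sqrt2}H_\mu$ and $Z=\frac{i}{\sqrt2}(X_\mu+X_{-\mu})$.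 Then $H\in\mathfrak p$, $iH\in\mathfrak k$, $\|H\|=\|iH\|=\|Z\|=1$ and $\|[H,Z]\|=\|[iH,Z]\|=\sqrt2$. -/

import Mathlib

open scoped Manifold ContDiff TensorProduct

noncomputable section

/-! ### Wang's constants -/

section Wang

variable {L : Type*} [LieRing L]

/-- The length `‖X‖ = ⟨X, X⟩ ^ (1/2)` of a vector for a symmetric form `ip = ⟨·, ·⟩`. -/
def formLength (ip : L → L → ℝ) (X : L) : ℝ := √(ip X X)

/-- The norm `N(f) = sup {‖f X‖ : ‖X‖ = 1}` of a map `f : L → L`. -/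
def operatorNorm (ip : L → L → ℝ) (f : L → L) : ℝ :=
  sSup {r : ℝ | ∃ X : L, formLength ip X = 1 ∧ r = formLength ip (f X)}

/-- `sup {N(ad X) : X ∈ S, ‖X‖ = 1}`. -/
def wangConstant (ip : L → L → ℝ) (S : Set L) : ℝ :=
  sSup {r : ℝ | ∃ X ∈ S, formLength ip X = 1 ∧ r = operatorNorm ip (fun Y => ⁅X, Y⁆)}

/-- Wang's constant `C₁`: the supremum is over the unit vectors of `𝔭`, the `-1` eigenspace of the
involution `θ`. -/
def wangC1 (ip : L → L → ℝ) (θ : L → L) : ℝ := wangConstant ip {X | θ X = -X}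

/-- Wang's constant `C₂`: the supremum is over the unit vectors of `𝔨`, the `+1` eigenspace of the
involution `θ`. -/
def wangC2 (ip : L → L → ℝ) (θ : L → L) : ℝ := wangConstant ip {X | θ X = X}

end Wang

/-! ### Maximal roots and the renormalized Killing form of a complex Lie algebra -/

section Roots

variable {L : Type*} [LieRing L] [LieAlgebra ℂ L]

/-- `μ` is the maximal root of `L` with respect to the Cartan subalgebra `𝔥` and some ordering of
the roots. The ordering is the one given by the values `Re α(x₀)` at an element `x₀ ∈ 𝔥` at which no
root has real part zero (so `α` is positive when `Re α(x₀) > 0`). Roots are the nonzero weights of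
`𝔥` acting on `L`. -/
def IsMaximalRoot (𝔥 : LieSubalgebra ℂ L) [LieRing.IsNilpotent 𝔥]
    (μ : LieModule.Weight ℂ 𝔥 L) : Prop :=
  μ.IsNonZero ∧ ∃ x₀ : 𝔥,
    (∀ α : LieModule.Weight ℂ 𝔥 L, α.IsNonZero → (α x₀).re ≠ 0) ∧
    ∀ α : LieModule.Weight ℂ 𝔥 L, α.IsNonZero → (α x₀).re ≤ (μ x₀).re

/-- `t ∈ 𝔥` is the vector `H_μ` dual to the linear form `μ` on `𝔥` with respect to `B`. -/
def IsDualVector (B : LinearMap.BilinForm ℂ L) (𝔥 : LieSubalgebra ℂ L) (μ : 𝔥 → ℂ) (t : 𝔥) :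
    Prop :=
  ∀ h : 𝔥, B t h = μ h

/-- `B` is the renormalized Killing form: the real multiple of the Killing form for which the
maximal root `μ` has length `√2`, i.e. `⟨μ, μ⟩ = B(H_μ, H_μ) = 2`. The roots are taken with
respect to a Cartan subalgebra `𝔥` that is stable under the involution `θ`; when `θ` is the
conjugation with respect to a compact real form `𝔨`, these are the complexifications of the maximal
abelian subalgebras of `𝔨`. -/
def IsRenormalizedKillingForm (θ : L → L) (B : LinearMap.BilinForm ℂ L) : Prop :=
  (∃ c : ℝ, B = (c : ℂ) • killingForm ℂ L) ∧
  ∃ (𝔥 : LieSubalgebra ℂ L) (_ : 𝔥.IsCartanSubalgebra) (μ : LieModule.Weight ℂ 𝔥 L) (t : 𝔥),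
    (∀ h ∈ 𝔥, θ h ∈ 𝔥) ∧ IsMaximalRoot 𝔥 μ ∧ IsDualVector B 𝔥 μ t ∧ B t t = 2

/-- The real form `⟨X, Y⟩ = -Re B(X, θ Y)` on `L`. For `θ` the conjugation with respect to a compact
real form `𝔨` and `B` a real multiple of the Killing form, it is `-B` on `𝔨`, it is `B` on
`𝔭 = i𝔨`, and `𝔨 ⟂ 𝔭`. -/
def cartanInner (B : LinearMap.BilinForm ℂ L) (θ : L → L) (X Y : L) : ℝ := -(B X (θ Y)).re

/-- `X` and `Y` can serve as the root vectors `X_α`, `X_{-α}` of a Weyl–Chevalley basis adapted to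
`θ`, where `t = H_α`: they span the root spaces, `[X_α, X_{-α}] = H_α`, and `θ X_α = -X_{-α}`, which
says that `i(X_α + X_{-α})` and `X_α - X_{-α}` are fixed by `θ`. -/
def IsWeylChevalleyPair (θ : L → L) (𝔥 : LieSubalgebra ℂ L) [LieRing.IsNilpotent 𝔥]
    (α : 𝔥 → ℂ) (t : 𝔥) (X Y : L) : Prop :=
  X ∈ LieAlgebra.rootSpace 𝔥 α ∧ Y ∈ LieAlgebra.rootSpace 𝔥 (-α) ∧ ⁅X, Y⁆ = (t : L) ∧ θ X = -Y

end Roots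

/-! ### The complexification of a real Lie group -/

section Complexification

/-- A smooth real or complex Lie group is smooth enough for Mathlib's bracket on its Lie algebra. -/
instance lieGroupMinSmoothness {𝕜 : Type*} [RCLike 𝕜] {E : Type*} [NormedAddCommGroup E]
    [NormedSpace 𝕜 E] {G : Type*} [TopologicalSpace G] [ChartedSpace E G] [Group G]
    [LieGroup 𝓘(𝕜, E) ∞ G] : LieGroup 𝓘(𝕜, E) (minSmoothness 𝕜 3) G := by
  rw [minSmoothness_of_isRCLikeNormedField]
  infer_instance

/-- `G` as a complexification of the real Lie group `K`: a complex Lie group `G` that contains `K`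
as a subgroup, through a smooth injective homomorphism, such that the inclusion of Lie algebras
`𝔨 → 𝔤` extends to an isomorphism `ℂ ⊗ 𝔨 ≃ 𝔤` of complex Lie algebras. -/
structure LieComplexification
    (E : Type*) [NormedAddCommGroup E] [NormedSpace ℝ E] [FiniteDimensional ℝ E]
    (K : Type*) [TopologicalSpace K] [ChartedSpace E K] [Group K] [LieGroup 𝓘(ℝ, E) ∞ K]
    (F : Type*) [NormedAddCommGroup F] [NormedSpace ℂ F] [FiniteDimensional ℂ F]
    (G : Type*) [TopologicalSpace G] [ChartedSpace F G] [Group G] [LieGroup 𝓘(ℂ, F) ∞ G] where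
  /-- The inclusion of `K` in `G`. -/
  incl : K →* G
  incl_injective : Function.Injective incl
  incl_smooth : ContMDiff 𝓘(ℝ, E) 𝓘(ℝ, F) ∞ incl
  /-- The isomorphism of complex Lie algebras `ℂ ⊗ 𝔨 ≃ 𝔤`. -/
  lieEquiv : ℂ ⊗[ℝ] (GroupLieAlgebra 𝓘(ℝ, E) K) ≃ₗ⁅ℂ⁆ GroupLieAlgebra 𝓘(ℂ, F) G
  /-- On `𝔨` the isomorphism is the derivative of the inclusion at the identity. -/
  lieEquiv_one_tmul : ∀ X : GroupLieAlgebra 𝓘(ℝ, E) K,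
    (lieEquiv ((1 : ℂ) ⊗ₜ[ℝ] X) : F) = (mfderiv 𝓘(ℝ, E) 𝓘(ℝ, F) incl (1 : K) X : F)

variable {E : Type*} [NormedAddCommGroup E] [NormedSpace ℝ E] [FiniteDimensional ℝ E]
  {K : Type*} [TopologicalSpace K] [ChartedSpace E K] [Group K] [LieGroup 𝓘(ℝ, E) ∞ K]
  {F : Type*} [NormedAddCommGroup F] [NormedSpace ℂ F] [FiniteDimensional ℂ F]
  {G : Type*} [TopologicalSpace G] [ChartedSpace F G] [Group G] [LieGroup 𝓘(ℂ, F) ∞ G]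

/-- The involution `X + iY ↦ X - iY` (`X, Y ∈ 𝔨`) of `𝔤 = 𝔨 ⊕ i𝔨`, with eigenspaces `𝔨` for `+1` and
`𝔭 = i𝔨` for `-1`. -/
def LieComplexification.cartanInvolution (D : LieComplexification E K F G)
    (Z : GroupLieAlgebra 𝓘(ℂ, F) G) : GroupLieAlgebra 𝓘(ℂ, F) G :=
  D.lieEquiv (LinearMap.rTensor (GroupLieAlgebra 𝓘(ℝ, E) K)
    Complex.conjAe.toLinearMap (D.lieEquiv.symm Z))

end Complexification

end

/-! Write `κ` for the Killing form of `𝔤`, `θ` for the conjugation, and `normSq θ X = -κ(X, θ X)`,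
the square of a Hermitian norm. Let `t_α` be the vector of `𝔥` dual to the root `α` for `κ`, and let
`M = normSq θ t_μ`. Everything reduces to the sharp bound `normSq [X, Y] ≤ M · normSq X · normSq Y`
for `X` in `𝔨` or in `𝔭`.

For `X ∈ 𝔨`, compactness lets an automorphism commuting with `θ` move `X` into `𝔥`
(`exists_equiv_mem_cartan`). There `ad X` is diagonal in the orthogonal root space decomposition,
with eigenvalues `α(X)`. Cauchy–Schwarz gives `|α(X)|² ≤ normSq t_α · normSq X`, and the maximal
root is a longest root (`re_apply_rootVec_le_of_isMaximalRoot`), so `M` bounds every `normSq t_α`.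
Multiplication by `i` preserves the norm and exchanges `𝔨` with `𝔭`, which covers the other case. If
`B = c κ` and `B(H_μ, H_μ) = 2`, then `c H_μ = t_μ` gives `2c = M`; in the norm of `B` the bound on
unit vectors becomes `√2`. The vectors `H`, `iH` and `Z` attain it. The bound itself also shows that
`M` does not depend on `𝔥` and `μ` (`normSq_rootVec_unique`).

What is needed from the group is collected in `IsCompactConjugation`. The derivative of `Ad` at the
identity is the bracket (`hasFDerivAt_adGroup_chart`). Averaging over Haar measure then yields an
invariant inner product, hence a negative definite Killing form on `𝔨`; maximizing a linear form on
an `Ad`-orbit makes a vector commute with a prescribed one. -/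

noncomputable section

/-! ### The adjoint action in the chart at the identity. -/

section GroupAdjoint

open VectorField Filter Topology

variable {E : Type*} [NormedAddCommGroup E] [NormedSpace ℝ E]
  {K : Type*} [TopologicalSpace K] [ChartedSpace E K] [Group K]

variable (E K) in
/-- The multiplication of a Lie group read in the preferred chart at the identity. -/
def chartMul (p : E × E) : E :=
  extChartAt 𝓘(ℝ, E) (1 : K)
    ((extChartAt 𝓘(ℝ, E) (1 : K)).symm p.1 * (extChartAt 𝓘(ℝ, E) (1 : K)).symm p.2)

/-- The adjoint action of a Lie group on its tangent space at the identity. -/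
def adGroup (k : K) : E →L[ℝ] E :=
  mfderiv 𝓘(ℝ, E) 𝓘(ℝ, E) (fun x : K => k * x * k⁻¹) 1

variable [LieGroup 𝓘(ℝ, E) ∞ K]

lemma contDiffAt_chartMul :
    ContDiffAt ℝ ∞ (chartMul E K)
      (extChartAt 𝓘(ℝ, E) (1 : K) 1, extChartAt 𝓘(ℝ, E) (1 : K) 1) := by
  rw [← contMDiffAt_iff_contDiffAt]
  unfold chartMul
  have h1 : ContMDiffAt 𝓘(ℝ, E) 𝓘(ℝ, E) ∞ (extChartAt 𝓘(ℝ, E) (1 : K)).symm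
      (extChartAt 𝓘(ℝ, E) (1 : K) 1) :=
    (contMDiffOn_extChartAt_symm (1 : K)).contMDiffAt (extChartAt_target_mem_nhds _)
  refine ContMDiffAt.comp (I' := 𝓘(ℝ, E)) _ (g := extChartAt 𝓘(ℝ, E) (1 : K)) ?_ ?_
  · simpa using contMDiffAt_extChartAt (I := 𝓘(ℝ, E)) (x := (1 : K)) (n := ∞)
  · exact (h1.comp (f := Prod.fst) (_, _) contDiff_fst.contMDiff.contMDiffAt).mul
      (h1.comp (f := Prod.snd) (_, _) contDiff_snd.contMDiff.contMDiffAt)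

lemma HasMFDerivAt.of_eq_point {M : Type*} [TopologicalSpace M] [ChartedSpace E M]
    {M' : Type*} [TopologicalSpace M'] [ChartedSpace E M'] {f : M → M'} {p q : M} {D : E →L[ℝ] E}
    (h : HasMFDerivAt 𝓘(ℝ, E) 𝓘(ℝ, E) f q D) (e : p = q) :
    HasMFDerivAt 𝓘(ℝ, E) 𝓘(ℝ, E) f p D := by
  subst e; exact h

/-- The tangent space at the identity is trivialized by this very chart, so the inverse chart has
derivative the identity there and contributes no factor. -/
lemma hasMFDerivAt_chart_comp {h : K → K} {g : K} (hg : g ∈ (chartAt E (1 : K)).source) (h1 : h 1 = g)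
    (hd : MDifferentiableAt 𝓘(ℝ, E) 𝓘(ℝ, E) h 1) :
    HasFDerivAt (fun y => extChartAt 𝓘(ℝ, E) (1 : K) (h ((extChartAt 𝓘(ℝ, E) (1 : K)).symm y)))
      ((mfderiv 𝓘(ℝ, E) 𝓘(ℝ, E) (extChartAt 𝓘(ℝ, E) (1 : K)) g : E →L[ℝ] E) ∘L
        (mfderiv 𝓘(ℝ, E) 𝓘(ℝ, E) h 1 : E →L[ℝ] E)) (extChartAt 𝓘(ℝ, E) (1 : K) 1) := by
  subst h1
  have hs : MDifferentiableAt 𝓘(ℝ, E) 𝓘(ℝ, E) (extChartAt 𝓘(ℝ, E) (1 : K)).symm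
      (extChartAt 𝓘(ℝ, E) (1 : K) 1) :=
    ((contMDiffOn_extChartAt_symm (n := ∞) (1 : K)).contMDiffAt
      (extChartAt_target_mem_nhds _)).mdifferentiableAt (by simp)
  have hs' : HasMFDerivAt 𝓘(ℝ, E) 𝓘(ℝ, E) (extChartAt 𝓘(ℝ, E) (1 : K)).symm
      (extChartAt 𝓘(ℝ, E) (1 : K) 1) (ContinuousLinearMap.id ℝ E) := by
    have h2 := mfderivWithin_range_extChartAt_symm (I := 𝓘(ℝ, E)) (x := (1 : K))
    have h3 := hs.hasMFDerivAt
    rw [ModelWithCorners.range_eq_univ, mfderivWithin_univ] at h2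
    rw [h2] at h3
    exact h3
  have e1 : (extChartAt 𝓘(ℝ, E) (1 : K)).symm (extChartAt 𝓘(ℝ, E) (1 : K) 1) = 1 :=
    extChartAt_to_inv _
  have hp : MDifferentiableAt 𝓘(ℝ, E) 𝓘(ℝ, E) (extChartAt 𝓘(ℝ, E) (1 : K)) (h 1) := by
    refine ((contMDiffOn_extChartAt (I := 𝓘(ℝ, E)) (n := ∞) (x := (1 : K))).contMDiffAt
      ?_).mdifferentiableAt (by simp)
    exact (chartAt E (1 : K)).open_source.mem_nhds hg
  have c1 := HasMFDerivAt.comp (1 : K) hp.hasMFDerivAt hd.hasMFDerivAt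
  have c2 := HasMFDerivAt.comp (extChartAt 𝓘(ℝ, E) (1 : K) 1) (c1.of_eq_point e1) hs'
  exact c2.hasFDerivAt

lemma mdifferentiableAt_groupMul_left (g h : K) :
    MDifferentiableAt 𝓘(ℝ, E) 𝓘(ℝ, E) (fun x : K => g * x) h :=
  (contMDiff_mul_left (I := 𝓘(ℝ, E)) (n := ∞)).contMDiffAt.mdifferentiableAt (by simp)

lemma mdifferentiableAt_groupMul_right (g h : K) :
    MDifferentiableAt 𝓘(ℝ, E) 𝓘(ℝ, E) (fun x : K => x * g) h :=
  (contMDiff_mul_right (I := 𝓘(ℝ, E)) (n := ∞)).contMDiffAt.mdifferentiableAt (by simp)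

/-- Left translation is multiplication with the first factor frozen. This exhibits left-invariant
fields as partial derivatives of one smooth map of two variables; the next lemma does the same for
right translation. -/
lemma eventually_fderiv_chartMul_inr :
    ∀ᶠ x in 𝓝 (extChartAt 𝓘(ℝ, E) (1 : K) 1),
      fderiv ℝ (chartMul E K) (x, extChartAt 𝓘(ℝ, E) (1 : K) 1) ∘L ContinuousLinearMap.inr ℝ E E =
      (mfderiv 𝓘(ℝ, E) 𝓘(ℝ, E) (extChartAt 𝓘(ℝ, E) (1 : K))
        ((extChartAt 𝓘(ℝ, E) (1 : K)).symm x) : E →L[ℝ] E) ∘L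
        (mfderiv 𝓘(ℝ, E) 𝓘(ℝ, E)
          (fun y : K => (extChartAt 𝓘(ℝ, E) (1 : K)).symm x * y) 1 : E →L[ℝ] E) := by
  have hc : ContinuousAt (fun x : E => (x, extChartAt 𝓘(ℝ, E) (1 : K) 1))
    (extChartAt 𝓘(ℝ, E) (1 : K) 1) := by fun_prop
  have hd := ((contDiffAt_chartMul (E := E) (K := K)).of_le (m := 1) (mod_cast le_top)).eventually (by simp)
  filter_upwards [hc.eventually hd, extChartAt_target_mem_nhds (I := 𝓘(ℝ, E)) (1 : K)] with x hx ht
  have h1 := (hx.differentiableAt (by simp)).hasFDerivAt.comp (extChartAt 𝓘(ℝ, E) (1 : K) 1)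
    (hasFDerivAt_prodMk_right x (extChartAt 𝓘(ℝ, E) (1 : K) 1))
  have h2 := hasMFDerivAt_chart_comp (h := fun y => (extChartAt 𝓘(ℝ, E) (1 : K)).symm x * y)
    (by simpa using (extChartAt 𝓘(ℝ, E) (1 : K)).map_target ht) (mul_one _) (mdifferentiableAt_groupMul_left _ _)
  exact h1.unique h2

lemma eventually_fderiv_chartMul_inl :
    ∀ᶠ x in 𝓝 (extChartAt 𝓘(ℝ, E) (1 : K) 1),
      fderiv ℝ (chartMul E K) (extChartAt 𝓘(ℝ, E) (1 : K) 1, x) ∘L ContinuousLinearMap.inl ℝ E E =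
      (mfderiv 𝓘(ℝ, E) 𝓘(ℝ, E) (extChartAt 𝓘(ℝ, E) (1 : K))
        ((extChartAt 𝓘(ℝ, E) (1 : K)).symm x) : E →L[ℝ] E) ∘L
        (mfderiv 𝓘(ℝ, E) 𝓘(ℝ, E)
          (fun y : K => y * (extChartAt 𝓘(ℝ, E) (1 : K)).symm x) 1 : E →L[ℝ] E) := by
  have hc : ContinuousAt (fun x : E => (extChartAt 𝓘(ℝ, E) (1 : K) 1, x))
    (extChartAt 𝓘(ℝ, E) (1 : K) 1) := by fun_prop
  have hd := ((contDiffAt_chartMul (E := E) (K := K)).of_le (m := 1) (mod_cast le_top)).eventually (by simp)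
  filter_upwards [hc.eventually hd, extChartAt_target_mem_nhds (I := 𝓘(ℝ, E)) (1 : K)] with x hx ht
  have h1 := (hx.differentiableAt (by simp)).hasFDerivAt.comp (f := fun y => (y, x)) (extChartAt 𝓘(ℝ, E) (1 : K) 1)
    (hasFDerivAt_prodMk_left (extChartAt 𝓘(ℝ, E) (1 : K) 1) x)
  have h2 := hasMFDerivAt_chart_comp (h := fun y => y * (extChartAt 𝓘(ℝ, E) (1 : K)).symm x)
    (by simpa using (extChartAt 𝓘(ℝ, E) (1 : K)).map_target ht) (one_mul _) (mdifferentiableAt_groupMul_right _ _)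
  exact h1.unique h2

lemma hasMFDerivAt_conj (k : K) :
    HasMFDerivAt 𝓘(ℝ, E) 𝓘(ℝ, E) (fun x : K => k * x * k⁻¹) 1 (adGroup k : E →L[ℝ] E) := by
  have : MDifferentiableAt 𝓘(ℝ, E) 𝓘(ℝ, E) (fun x : K => k * x * k⁻¹) 1 :=
    (mdifferentiableAt_groupMul_right (k⁻¹) (k * 1)).comp (1 : K) (mdifferentiableAt_groupMul_left k 1)
  exact this.hasMFDerivAt

lemma adGroup_one : adGroup (1 : K) = ContinuousLinearMap.id ℝ E := by
  have h := hasMFDerivAt_conj (E := E) (1 : K)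
  have h2 : HasMFDerivAt 𝓘(ℝ, E) 𝓘(ℝ, E) (fun x : K => 1 * x * 1⁻¹) 1
      (ContinuousLinearMap.id ℝ E) := by
    have e : (fun x : K => 1 * x * 1⁻¹) = id := by ext x; simp
    rw [e]
    exact hasMFDerivAt_id 1
  exact hasMFDerivAt_unique h h2

lemma adGroup_mul (g h : K) :
    adGroup (E := E) (g * h) = (adGroup g).comp (adGroup h) := by
  have h1 := hasMFDerivAt_conj (E := E) (g * h)
  have h2 := HasMFDerivAt.comp (1 : K) ((hasMFDerivAt_conj (E := E) g).of_eq_point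
    (show h * 1 * h⁻¹ = 1 by simp)) (hasMFDerivAt_conj (E := E) h)
  have e : (fun x : K => g * h * x * (g * h)⁻¹) = (fun x => g * x * g⁻¹) ∘ fun x => h * x * h⁻¹ := by
    ext x; simp [mul_assoc]
  rw [e] at h1
  exact hasMFDerivAt_unique h1 h2

/-- This is the derivative of `(g x g⁻¹) g = g x`. It expresses `Ad g` through the two translations,
whose dependence on `g` is known to be smooth. -/
lemma mfderiv_mul_right_comp_adGroup (g : K) :
    (mfderiv 𝓘(ℝ, E) 𝓘(ℝ, E) (fun y : K => y * g) 1 : E →L[ℝ] E) ∘L (adGroup g : E →L[ℝ] E) =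
      (mfderiv 𝓘(ℝ, E) 𝓘(ℝ, E) (fun y : K => g * y) 1 : E →L[ℝ] E) := by
  have h2 := HasMFDerivAt.comp (1 : K) ((mdifferentiableAt_groupMul_right (E := E) g
    1).hasMFDerivAt.of_eq_point (show g * 1 * g⁻¹ = 1 by simp)) (hasMFDerivAt_conj (E := E) g)
  have e : (fun y : K => y * g) ∘ (fun x => g * x * g⁻¹) = fun y => g * y := by
    ext x; simp [mul_assoc]
  rw [e] at h2
  have h3 := (mdifferentiableAt_groupMul_left (E := E) g 1).hasMFDerivAt
  have h4 := hasMFDerivAt_unique h2 h3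
  exact h4

end GroupAdjoint

/-! ### The derivative of the adjoint action is the bracket. -/

section GroupAdjoint

open VectorField Filter Topology

variable {E : Type*} [NormedAddCommGroup E] [NormedSpace ℝ E]
  {K : Type*} [TopologicalSpace K] [ChartedSpace E K] [Group K] [LieGroup 𝓘(ℝ, E) ∞ K]

lemma mpullbackWithin_mulInvariantVectorField_eventuallyEq (v : GroupLieAlgebra 𝓘(ℝ, E) K) :
    (mpullbackWithin 𝓘(ℝ, E) 𝓘(ℝ, E) (extChartAt 𝓘(ℝ, E) (1 : K)).symm
      (mulInvariantVectorField v) (Set.range 𝓘(ℝ, E)) : E → E)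
      =ᶠ[𝓝 (extChartAt 𝓘(ℝ, E) (1 : K) 1)]
    fun x => (fderiv ℝ (chartMul E K) (x, extChartAt 𝓘(ℝ, E) (1 : K) 1) ∘L
      ContinuousLinearMap.inr ℝ E E) v := by
  filter_upwards [eventually_fderiv_chartMul_inr (E := E) (K := K),
    extChartAt_target_mem_nhds (I := 𝓘(ℝ, E)) (1 : K)] with x hx ht
  rw [hx]
  have h1 := mfderivWithin_extChartAt_symm_comp_mfderiv_extChartAt ht
  have h2 := mfderiv_extChartAt_comp_mfderivWithin_extChartAt_symm ht
  have h3 := ContinuousLinearMap.inverse_eq h1 h2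
  rw [mpullbackWithin_apply, h3]
  rfl

variable (K) in
/-- The bracket of the Lie algebra of a Lie group, as an operation on the model space. -/
def modelBracket : E → E → E :=
  (fun v w => ⁅v, w⁆ :
    GroupLieAlgebra 𝓘(ℝ, E) K → GroupLieAlgebra 𝓘(ℝ, E) K → GroupLieAlgebra 𝓘(ℝ, E) K)

lemma groupLieAlgebra_bracket_eq_lieBracket (v w : GroupLieAlgebra 𝓘(ℝ, E) K) :
    (⁅v, w⁆ : GroupLieAlgebra 𝓘(ℝ, E) K) = lieBracket ℝ (E := E)
      (mpullbackWithin 𝓘(ℝ, E) 𝓘(ℝ, E) (extChartAt 𝓘(ℝ, E) (1 : K)).symm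
        (mulInvariantVectorField v) (Set.range 𝓘(ℝ, E)) : E → E)
      (mpullbackWithin 𝓘(ℝ, E) 𝓘(ℝ, E) (extChartAt 𝓘(ℝ, E) (1 : K)).symm
        (mulInvariantVectorField w) (Set.range 𝓘(ℝ, E)) : E → E)
      (extChartAt 𝓘(ℝ, E) (1 : K) 1) := by
  have key : ∀ T : E →L[ℝ] E, T = ContinuousLinearMap.id ℝ E → ∀ z, T.inverse z = z := by
    rintro T rfl z; simp
  rw [GroupLieAlgebra.bracket_def, ← mlieBracketWithin_univ, mlieBracketWithin_apply]
  refine (key _ mfderiv_extChartAt_self _).trans ?_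
  rw [Set.preimage_univ, ModelWithCorners.range_eq_univ, Set.inter_univ]
  exact congrFun lieBracketWithin_univ _

/-- In the chart, `R(x) ∘ Ad(x) = A(x)`, where `R` and `A` are the partial derivatives of
multiplication given by right and left translation. All three are the identity at the base point, so
`Ad' = A' - R'` there. Symmetry of the second derivative `D` turns this into `D(v,0)(0,w) -
D(w,0)(0,v)`, the bracket of the left-invariant fields of `v` and `w`. -/
lemma hasFDerivAt_adGroup_chart [CompleteSpace E] :
    ∃ a' : E →L[ℝ] E →L[ℝ] E,
      HasFDerivAt (fun x => (adGroup ((extChartAt 𝓘(ℝ, E) (1 : K)).symm x) : E →L[ℝ] E)) a'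
        (extChartAt 𝓘(ℝ, E) (1 : K) 1) ∧
      ∀ v w : E, a' v w = modelBracket K v w := by
  set e := extChartAt 𝓘(ℝ, E) (1 : K) 1 with he
  set A : E → E →L[ℝ] E := fun x => fderiv ℝ (chartMul E K) (x, e) ∘L
    ContinuousLinearMap.inr ℝ E E with hA
  set R : E → E →L[ℝ] E := fun x => fderiv ℝ (chartMul E K) (e, x) ∘L
    ContinuousLinearMap.inl ℝ E E with hR
  set a : E → E →L[ℝ] E := fun x => adGroup ((extChartAt 𝓘(ℝ, E) (1 : K)).symm x) with ha
  have e1 : (extChartAt 𝓘(ℝ, E) (1 : K)).symm e = 1 := extChartAt_to_inv _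
  have hae : a e = ContinuousLinearMap.id ℝ E := by
    simp only [ha, e1]; exact adGroup_one
  have hRa : ∀ᶠ x in 𝓝 e, R x ∘L a x = A x := by
    filter_upwards [eventually_fderiv_chartMul_inr (E := E) (K := K),
      eventually_fderiv_chartMul_inl (E := E) (K := K)] with x h1 h2
    simp only [hR, hA, ha]
    rw [h1, h2]
    exact congrArg (fun T : E →L[ℝ] E => (mfderiv 𝓘(ℝ, E) 𝓘(ℝ, E) (extChartAt 𝓘(ℝ, E) (1 : K))
        ((extChartAt 𝓘(ℝ, E) (1 : K)).symm x) : E →L[ℝ] E) ∘L T)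
      (mfderiv_mul_right_comp_adGroup ((extChartAt 𝓘(ℝ, E) (1 : K)).symm x))
  have hRe : R e = ContinuousLinearMap.id ℝ E := by
    have h2 := (eventually_fderiv_chartMul_inl (E := E) (K := K)).self_of_nhds
    rw [← he, e1, mfderiv_extChartAt_self] at h2
    simp only [hR]
    rw [h2]
    have e2 : (fun y : K => y * 1) = id := by ext; simp
    have h3 : (mfderiv 𝓘(ℝ, E) 𝓘(ℝ, E) (fun y : K => y * 1) 1 : E →L[ℝ] E) =
      ContinuousLinearMap.id ℝ E := by
      rw [e2]; exact mfderiv_id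
    rw [h3]; rfl
  have hAe : A e = ContinuousLinearMap.id ℝ E := by
    rw [← hRa.self_of_nhds, hRe, hae]; rfl
  have hf2 : ContDiffAt ℝ 2 (chartMul E K) (e, e) :=
    (contDiffAt_chartMul (E := E) (K := K)).of_le
      ENat.LEInfty.out
  have hsymm : IsSymmSndFDerivAt ℝ (chartMul E K) (e, e) := hf2.isSymmSndFDerivAt (by simp)
  have hD : HasFDerivAt (fderiv ℝ (chartMul E K)) (fderiv ℝ (fderiv ℝ (chartMul E K)) (e, e))
      (e, e) :=
    ((hf2.fderiv_right (m := 1) (by norm_num)).differentiableAt (by simp)).hasFDerivAt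
  set D := fderiv ℝ (fderiv ℝ (chartMul E K)) (e, e) with hDdef
  have hA' : ∃ A', HasFDerivAt A A' e ∧ ∀ w v, A' w v = D (w, 0) (0, v) :=
    ⟨_, (hD.comp (f := fun x => (x, e)) e (hasFDerivAt_prodMk_left e e)).clm_comp
      (hasFDerivAt_const _ _), fun w v => by simp⟩
  have hR' : ∃ R', HasFDerivAt R R' e ∧ ∀ w v, R' w v = D (0, w) (v, 0) :=
    ⟨_, (hD.comp (f := fun x => (e, x)) e (hasFDerivAt_prodMk_right e e)).clm_comp
      (hasFDerivAt_const _ _), fun w v => by simp⟩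
  obtain ⟨A', hA', hAD⟩ := hA'
  obtain ⟨R', hR', hRD⟩ := hR'
  -- Invertible operators form an open set, so `Ad = R⁻¹ A` near the base point; this is where
  -- differentiability of `Ad` comes from.
  have hinv : ∀ᶠ x in 𝓝 e, (R x).IsInvertible := by
    have : Set.range ((↑) : (E ≃L[ℝ] E) → (E →L[ℝ] E)) ∈ 𝓝 (R e) := by
      rw [hRe]; exact ContinuousLinearEquiv.nhds (ContinuousLinearEquiv.refl ℝ E)
    filter_upwards [hR'.continuousAt this] with x hx
    exact hx
  have hda : DifferentiableAt ℝ a e := by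
    have h1 : DifferentiableAt ℝ ContinuousLinearMap.inverse (R e) := by
      have : ContDiffAt ℝ 1 ContinuousLinearMap.inverse (R e) :=
        ContinuousLinearMap.IsInvertible.contDiffAt_map_inverse hinv.self_of_nhds
      exact this.differentiableAt (by simp)
    have h2 : DifferentiableAt ℝ (fun x => (R x).inverse ∘L A x) e :=
      (h1.comp e hR'.differentiableAt).clm_comp hA'.differentiableAt
    refine h2.congr_of_eventuallyEq ?_
    filter_upwards [hRa, hinv] with x h3 h4
    rw [← h3, ← ContinuousLinearMap.comp_assoc, h4.inverse_comp_self,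
      ContinuousLinearMap.id_comp]
  have h5 : HasFDerivAt A _ e := (hR'.clm_comp hda.hasFDerivAt).congr_of_eventuallyEq
    (hRa.mono fun x h => h.symm)
  have h7 : ∀ v w : E, fderiv ℝ a e v w = D (v, 0) (0, w) - D (w, 0) (0, v) := by
    intro v w
    have h6 : fderiv ℝ a e v w + R' v w = A' v w := by
      have := congrArg (fun T : E →L[ℝ] E →L[ℝ] E => T v w) (h5.unique hA')
      simpa [hRe, hae] using this
    rw [hAD, hRD, show D (0, v) (w, 0) = D (w, 0) (0, v) from hsymm (0, v) (w, 0)] at h6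
    rw [← h6]
    abel
  have hfA : ∀ v w : E, fderiv ℝ (fun x => A x v) e w = D (w, 0) (0, v) := by
    intro v w
    rw [(hA'.clm_apply (hasFDerivAt_const v e)).fderiv]
    simp [hAD]
  refine ⟨fderiv ℝ a e, hda.hasFDerivAt, fun v w => ?_⟩
  have h8 : modelBracket K v w =
      lieBracket ℝ (E := E) (fun x => A x v) (fun x => A x w) e := by
    refine (groupLieAlgebra_bracket_eq_lieBracket (K := K) v w).trans ?_
    exact Filter.EventuallyEq.lieBracket_vectorField_eq (E := E)
      (mpullbackWithin_mulInvariantVectorField_eventuallyEq v)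
      (mpullbackWithin_mulInvariantVectorField_eventuallyEq w)
  refine (h7 v w).trans (Eq.trans ?_ h8.symm)
  have h9 : lieBracket ℝ (E := E) (fun x => A x v) (fun x => A x w) e =
    fderiv ℝ (fun x => A x w) e (A e v) - fderiv ℝ (fun x => A x v) e (A e w) := rfl
  refine Eq.trans ?_ h9.symm
  have h10 := hfA w (A e v)
  have h11 := hfA v (A e w)
  refine Eq.symm ((congrArg₂ (fun p q : E => p - q) h10 h11).trans ?_)
  rw [hAe]
  rfl

end GroupAdjoint

/-! ### Infinitesimal consequences of statements about the adjoint action. -/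

section GroupAdjoint

open VectorField Filter Topology

variable {E : Type*} [NormedAddCommGroup E] [NormedSpace ℝ E]
  {K : Type*} [TopologicalSpace K] [ChartedSpace E K] [Group K] [LieGroup 𝓘(ℝ, E) ∞ K]

/-- The chart gives continuity at the identity, and multiplicativity of `Ad` carries it to every
point. -/
lemma continuous_adGroup [CompleteSpace E] :
    Continuous fun k : K => adGroup (E := E) k := by
  have : IsTopologicalGroup K := topologicalGroup_of_lieGroup 𝓘(ℝ, E) ∞
  obtain ⟨a', ha, -⟩ := hasFDerivAt_adGroup_chart (E := E) (K := K)
  have h1 : ContinuousAt (fun k : K => adGroup (E := E) k) 1 := by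
    have h2 : ContinuousAt ((fun x => (adGroup ((extChartAt 𝓘(ℝ, E) (1 : K)).symm x) : E →L[ℝ] E)) ∘
      extChartAt 𝓘(ℝ, E) (1 : K)) 1 :=
      ContinuousAt.comp ha.continuousAt (continuousAt_extChartAt (1 : K))
    refine h2.congr ?_
    filter_upwards [extChartAt_source_mem_nhds (I := 𝓘(ℝ, E)) (1 : K)] with k hk
    simp only [Function.comp, (extChartAt 𝓘(ℝ, E) (1 : K)).left_inv hk]
  rw [continuous_iff_continuousAt]
  intro k
  have h3 : (fun x : K => adGroup (E := E) x) =
      (fun T : E →L[ℝ] E => adGroup (E := E) k ∘L T) ∘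
        (fun x : K => adGroup (E := E) x) ∘ (fun x => k⁻¹ * x) := by
    ext1 x
    have := adGroup_mul (E := E) k (k⁻¹ * x)
    rw [mul_inv_cancel_left] at this
    exact this
  rw [h3]
  refine ContinuousAt.comp ?_ (ContinuousAt.comp ?_ ?_)
  · exact (continuous_const.clm_comp continuous_id).continuousAt
  · simpa using h1
  · fun_prop

/-- The function `k ↦ l (Ad k w)` has a maximum at the identity, so its derivative `v ↦ l [v, w]`
vanishes. -/
lemma apply_bracket_eq_zero_of_forall_le [CompleteSpace E] (l : E →L[ℝ] ℝ)
    (w : E)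
    (h : ∀ k : K, l (adGroup k w) ≤ l w) (v : E) :
    l (modelBracket K v w) = 0 := by
  obtain ⟨a', ha, hb⟩ := hasFDerivAt_adGroup_chart (E := E) (K := K)
  have h1 := l.hasFDerivAt.comp _ (ha.clm_apply (hasFDerivAt_const (w : E) _))
  have hm : IsLocalMax (l ∘ fun x =>
      (adGroup ((extChartAt 𝓘(ℝ, E) (1 : K)).symm x) : E →L[ℝ] E) w)
      (extChartAt 𝓘(ℝ, E) (1 : K) 1) := by
    refine Filter.Eventually.of_forall fun x => ?_
    simp only [Function.comp, extChartAt_to_inv, adGroup_one]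
    exact h _
  have h2 := hm.hasFDerivAt_eq_zero h1
  have h3 := congrArg (fun T : E →L[ℝ] ℝ => T v) h2
  have h4 : l (a' v w) = 0 := by simpa using h3
  rw [← h4]
  exact congrArg l (hb v w).symm

lemma skew_of_adGroup_invariant [CompleteSpace E] (b : E →L[ℝ] E →L[ℝ] ℝ)
    (h : ∀ (k : K) (v w : E), b (adGroup k v) (adGroup k w) = b v w)
    (u v w : E) :
    b (modelBracket K u v) w + b v (modelBracket K u w) = 0 := by
  obtain ⟨a', ha, hb⟩ := hasFDerivAt_adGroup_chart (E := E) (K := K)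
  have h1 := (b.hasFDerivAt.comp _ (ha.clm_apply (hasFDerivAt_const (v : E) _))).clm_apply
    (ha.clm_apply (hasFDerivAt_const (w : E) _))
  have h2 : (fun x => b ((adGroup ((extChartAt 𝓘(ℝ, E) (1 : K)).symm x) : E →L[ℝ] E) v)
      ((adGroup ((extChartAt 𝓘(ℝ, E) (1 : K)).symm x) : E →L[ℝ] E) w)) = fun _ => b v w := by
    ext x; exact h _ v w
  have h3 := h1.unique (by
    have := hasFDerivAt_const (𝕜 := ℝ) (b v w) (extChartAt 𝓘(ℝ, E) (1 : K) 1)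
    rw [← h2] at this; exact this)
  have h4 := congrArg (fun T : E →L[ℝ] ℝ => T u) h3
  have h5 : b (a' u v) w + b v (a' u w) = 0 := by
    simp [adGroup_one] at h4
    linarith
  rw [← h5]
  exact congrArg₂ (fun p q : E => b p w + b v q) (hb u v).symm (hb u w).symm

/-- Differentiate `Ad g ∘ Ad x = Ad (g x g⁻¹) ∘ Ad g` in `x` at the identity. -/
lemma adGroup_lie [CompleteSpace E] (g : K) (v w : E) :
    adGroup g (modelBracket K v w) = modelBracket K (adGroup g v) (adGroup g w) := by
  have : IsTopologicalGroup K := topologicalGroup_of_lieGroup 𝓘(ℝ, E) ∞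
  obtain ⟨a', ha, hb⟩ := hasFDerivAt_adGroup_chart (E := E) (K := K)
  set φ := extChartAt 𝓘(ℝ, E) (1 : K) with hφ
  have hc : HasFDerivAt (fun y => φ (g * φ.symm y * g⁻¹)) (adGroup (E := E) g) (φ 1) := by
    have h1 := hasMFDerivAt_chart_comp (E := E) (h := fun x : K => g * x * g⁻¹) (g := 1)
      (mem_chart_source E (1 : K)) (by simp) (hasMFDerivAt_conj g).mdifferentiableAt
    refine h1.congr_fderiv ?_
    have h2 : (mfderiv 𝓘(ℝ, E) 𝓘(ℝ, E) (extChartAt 𝓘(ℝ, E) (1 : K)) 1 : E →L[ℝ] E) =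
      ContinuousLinearMap.id ℝ E := mfderiv_extChartAt_self
    rw [h2]
    rfl
  have hce : φ (g * φ.symm (φ 1) * g⁻¹) = φ 1 := by
    rw [extChartAt_to_inv]; simp
  have h3 := HasFDerivAt.comp (g := fun x => adGroup (E := E) (φ.symm x)) (φ 1)
    (by rw [hce]; exact ha) hc
  have h4 : (fun x => (adGroup (E := E) g) ∘L adGroup (E := E) (φ.symm x)) =ᶠ[𝓝 (φ 1)]
      fun x => adGroup (E := E) (φ.symm (φ (g * φ.symm x * g⁻¹))) ∘L
        (adGroup (E := E) g) := by
    have h5 : ContinuousAt (fun x => g * φ.symm x * g⁻¹) (φ 1) := by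
      have := continuousAt_extChartAt_symm (I := 𝓘(ℝ, E)) (1 : K)
      exact (continuousAt_const.mul this).mul continuousAt_const
    have h6 : φ.source ∈ 𝓝 (g * φ.symm (φ 1) * g⁻¹) := by
      rw [extChartAt_to_inv, mul_one, mul_inv_cancel]
      exact extChartAt_source_mem_nhds (I := 𝓘(ℝ, E)) (1 : K)
    filter_upwards [h5 h6] with x hx
    rw [φ.left_inv hx]
    have h7 := adGroup_mul (E := E) g (φ.symm x)
    have h8 := adGroup_mul (E := E) (g * φ.symm x * g⁻¹) g
    rw [inv_mul_cancel_right] at h8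
    exact h7.symm.trans h8
  have h9 : HasFDerivAt _ _ (φ 1) := (hasFDerivAt_const (adGroup (E := E) g) (φ 1)).clm_comp ha
  have h10 : HasFDerivAt _ _ (φ 1) := (h3.clm_comp
    (hasFDerivAt_const (adGroup (E := E) g) (φ 1))).congr_of_eventuallyEq h4
  have h11 := congrArg (fun T : E →L[ℝ] E →L[ℝ] E => T v w) (h9.unique h10)
  have h12 : (adGroup (E := E) g) (a' v w) = a' ((adGroup (E := E) g) v)
    ((adGroup (E := E) g) w) := by simpa using h11
  refine (congrArg (adGroup g) (hb v w).symm).trans (h12.trans (hb _ _))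

end GroupAdjoint

/-! ### Compactness: extremal points of orbits and Haar averaging. -/

section GroupAdjoint

open Filter Topology MeasureTheory

variable {E : Type*} [NormedAddCommGroup E] [NormedSpace ℝ E] [FiniteDimensional ℝ E]
  {K : Type*} [TopologicalSpace K] [ChartedSpace E K] [Group K] [LieGroup 𝓘(ℝ, E) ∞ K]
  [CompactSpace K]

/-- Hunt's argument for conjugacy of maximal tori: `l` attains a maximum on the compact orbit of
`w`, and the maximum point is critical. -/
lemma exists_adGroup_apply_bracket_eq_zero (l : E →L[ℝ] ℝ) (w : E) :
    ∃ k : K, ∀ v : E, l (modelBracket K v (adGroup k w)) = 0 := by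
  have := FiniteDimensional.complete ℝ E
  have hc : Continuous fun k : K => l (adGroup k w) :=
    l.continuous.comp (continuous_adGroup.clm_apply continuous_const)
  obtain ⟨k, -, hk⟩ := isCompact_univ.exists_isMaxOn (Set.univ_nonempty (α := K)) hc.continuousOn
  refine ⟨k, apply_bracket_eq_zero_of_forall_le l _ fun g => ?_⟩
  have h1 := hk (Set.mem_univ (g * k))
  simpa [adGroup_mul] using h1

-- Average a Euclidean inner product over Haar measure. The inverse in `Ad k⁻¹` makes the left
-- invariance of the measure the one that is needed.
variable (E K) in
lemma exists_invariant_form : ∃ b : E →ₗ[ℝ] E →ₗ[ℝ] ℝ, (∀ v w, b v w = b w v) ∧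
    (∀ v, v ≠ 0 → 0 < b v v) ∧ ∀ (k : K) (v w : E), b (adGroup k v) (adGroup k w) = b v w := by
  have := FiniteDimensional.complete ℝ E
  have : IsTopologicalGroup K := topologicalGroup_of_lieGroup 𝓘(ℝ, E) ∞
  have : LocallyCompactSpace K := Manifold.locallyCompact_of_finiteDimensional 𝓘(ℝ, E)
  let _ : MeasurableSpace K := borel K
  have : BorelSpace K := ⟨rfl⟩
  let μ : Measure K := Measure.haar
  let F : E → E → K → ℝ := fun v w k =>
    inner ℝ (toEuclidean (adGroup k⁻¹ v)) (toEuclidean (adGroup k⁻¹ w))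
  have hA : ∀ v : E, Continuous fun k : K => toEuclidean (adGroup k⁻¹ v) := fun v =>
    toEuclidean.continuous.comp
      ((continuous_adGroup.comp continuous_inv).clm_apply continuous_const)
  have hF : ∀ v w, Continuous (F v w) := fun v w => (hA v).inner (hA w)
  have hI : ∀ v w, Integrable (F v w) μ := fun v w =>
    (hF v w).integrable_of_hasCompactSupport (HasCompactSupport.of_compactSpace _)
  refine ⟨LinearMap.mk₂ ℝ (fun v w => ∫ k, F v w k ∂μ) ?_ ?_ ?_ ?_, ?_, ?_, ?_⟩
  · intro v v' w
    rw [← integral_add (hI _ _) (hI _ _)]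
    simp [F, inner_add_left]
  · intro c v w
    rw [smul_eq_mul, ← integral_const_mul]
    simp [F, inner_smul_left]
  · intro v w w'
    rw [← integral_add (hI _ _) (hI _ _)]
    simp [F, inner_add_right]
  · intro c v w
    rw [smul_eq_mul, ← integral_const_mul]
    simp [F, inner_smul_right]
  · intro v w
    simp only [LinearMap.mk₂_apply, F]
    congr 1; ext k
    exact real_inner_comm _ _
  · intro v hv
    simp only [LinearMap.mk₂_apply]
    refine (hF v v).integral_pos_of_hasCompactSupport_nonneg_nonzero
      (HasCompactSupport.of_compactSpace _) (fun k => real_inner_self_nonneg) (x := 1) ?_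
    simp [F, adGroup_one, hv]
  · intro g v w
    simp only [LinearMap.mk₂_apply]
    rw [← integral_mul_left_eq_self (F v w) g⁻¹]
    congr 1; ext k
    simp [F, adGroup_mul]

/-- The adjoint action by automorphisms of the Lie algebra. -/
def adLieEquiv (k : K) : GroupLieAlgebra 𝓘(ℝ, E) K ≃ₗ⁅ℝ⁆ GroupLieAlgebra 𝓘(ℝ, E) K :=
  have := FiniteDimensional.complete ℝ E
  have h : ∀ g h : K, g * h = 1 → ∀ v : E, adGroup g (adGroup h v) = v := fun g h e v => by
    have := adGroup_mul (E := E) g h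
    rw [e, adGroup_one] at this
    exact (congrArg (fun T : E →L[ℝ] E => T v) this).symm
  { toFun := fun v => (adGroup k (v : E) : E)
    invFun := fun v => (adGroup k⁻¹ (v : E) : E)
    map_add' := fun v w => map_add (adGroup (E := E) k) v w
    map_smul' := fun c v => map_smul (adGroup (E := E) k) c v
    map_lie' := fun {v w} => adGroup_lie (E := E) k v w
    left_inv := fun v => h k⁻¹ k (by simp) v
    right_inv := fun v => h k k⁻¹ (by simp) v }

variable (E K) in
lemma exists_skew_form : ∃ b : LinearMap.BilinForm ℝ (GroupLieAlgebra 𝓘(ℝ, E) K),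
    (∀ v w, b v w = b w v) ∧ (∀ v, v ≠ 0 → 0 < b v v) ∧
    ∀ u v w : GroupLieAlgebra 𝓘(ℝ, E) K, b ⁅u, v⁆ w + b v ⁅u, w⁆ = 0 := by
  have := FiniteDimensional.complete ℝ E
  obtain ⟨b, h1, h2, h3⟩ := exists_invariant_form E K
  refine ⟨b, h1, h2, fun u v w => ?_⟩
  let b' : E →L[ℝ] E →L[ℝ] ℝ :=
    (LinearMap.toContinuousLinearMap.toLinearMap ∘ₗ b).toContinuousLinearMap
  exact skew_of_adGroup_invariant (E := E) (K := K) b' h3 u v w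

lemma exists_lieEquiv_apply_lie_eq_zero (l : GroupLieAlgebra 𝓘(ℝ, E) K →ₗ[ℝ] ℝ)
    (w : GroupLieAlgebra 𝓘(ℝ, E) K) :
    ∃ φ : GroupLieAlgebra 𝓘(ℝ, E) K ≃ₗ⁅ℝ⁆ GroupLieAlgebra 𝓘(ℝ, E) K,
      ∀ v : GroupLieAlgebra 𝓘(ℝ, E) K, l ⁅v, φ w⁆ = 0 := by
  let l' : E →ₗ[ℝ] ℝ := l
  obtain ⟨k, hk⟩ := exists_adGroup_apply_bracket_eq_zero (K := K) l'.toContinuousLinearMap w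
  exact ⟨adLieEquiv k, hk⟩

end GroupAdjoint

/-! ### The Hermitian form of a compact conjugation. -/

section CompactConjugation

open LieAlgebra LieModule ComplexConjugate

variable {L : Type*} [LieRing L] [LieAlgebra ℂ L]

/-- `θ` behaves as the conjugation of a complex Lie algebra with respect to the Lie algebra of a
compact group. -/
structure IsCompactConjugation (θ : L → L) : Prop where
  map_add : ∀ X Y, θ (X + Y) = θ X + θ Y
  map_smul : ∀ (c : ℂ) X, θ (c • X) = conj c • θ X
  map_lie : ∀ X Y, θ ⁅X, Y⁆ = ⁅θ X, θ Y⁆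
  involutive : ∀ X, θ (θ X) = X
  killingForm_map : ∀ X Y, killingForm ℂ L (θ X) (θ Y) = conj (killingForm ℂ L X Y)
  pos : ∀ X, X ≠ 0 → 0 < -(killingForm ℂ L X (θ X)).re
  -- This replaces conjugacy of maximal tori: for regular `a`, commuting with `a` means lying in its
  -- Cartan subalgebra. The last field supplies such a regular element.
  exists_conj : ∀ a X, θ a = a → θ X = X →
    ∃ φ : L ≃ₗ⁅ℂ⁆ L, (∀ Y, φ (θ Y) = θ (φ Y)) ∧ ⁅φ X, a⁆ = 0
  exists_regular : ∃ x, θ x = x ∧ ∀ Y Z : L, ⁅x, Y⁆ = 0 → ⁅x, Z⁆ = 0 → ⁅Y, Z⁆ = 0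

namespace IsCompactConjugation

variable {θ : L → L} (hθ : IsCompactConjugation θ)

/-- The square of the norm of a vector in the Hermitian form `-κ(X, θ Y)`. -/
def normSq (θ : L → L) (X : L) : ℝ := -(killingForm ℂ L X (θ X)).re

include hθ

lemma map_zero : θ 0 = 0 := by simpa using hθ.map_smul 0 0

lemma map_neg (X : L) : θ (-X) = -θ X := by simpa using hθ.map_smul (-1) X

lemma map_sub (X Y : L) : θ (X - Y) = θ X - θ Y := by
  rw [sub_eq_add_neg, hθ.map_add, hθ.map_neg, sub_eq_add_neg]

lemma map_sum {ι : Type*} (s : Finset ι) (f : ι → L) : θ (∑ i ∈ s, f i) = ∑ i ∈ s, θ (f i) := by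
  classical
  induction s using Finset.induction_on with
  | empty => simpa using hθ.map_zero
  | insert a s ha ih => rw [Finset.sum_insert ha, Finset.sum_insert ha, hθ.map_add, ih]

lemma killingForm_self (X : L) : killingForm ℂ L X (θ X) = -(normSq θ X : ℂ) := by
  have h1 := hθ.killingForm_map X (θ X)
  rw [hθ.involutive, LieModule.traceForm_comm] at h1
  have := Complex.conj_eq_iff_real.1 h1.symm
  obtain ⟨r, hr⟩ := this
  simp [normSq, hr]

lemma normSq_pos {X : L} (hX : X ≠ 0) : 0 < normSq θ X := hθ.pos X hX

omit hθ in
lemma normSq_zero : normSq θ (0 : L) = 0 := by simp [normSq]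

lemma normSq_nonneg (X : L) : 0 ≤ normSq θ X := by
  by_cases hX : X = 0
  · rw [hX, normSq_zero]
  · exact (hθ.normSq_pos hX).le

lemma normSq_eq_zero {X : L} : normSq θ X = 0 ↔ X = 0 :=
  ⟨fun h => by_contra fun hX => (hθ.normSq_pos hX).ne' h, fun h => h ▸ normSq_zero⟩

lemma normSq_smul (c : ℂ) (X : L) : normSq θ (c • X) = Complex.normSq c * normSq θ X := by
  simp only [normSq, hθ.map_smul, _root_.map_smul, LinearMap.smul_apply, smul_eq_mul]
  rw [← mul_assoc, mul_comm (conj c) c, Complex.mul_conj, Complex.re_ofReal_mul]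
  ring

omit hθ in
lemma normSq_equiv (φ : L ≃ₗ⁅ℂ⁆ L) (hφ : ∀ Y, φ (θ Y) = θ (φ Y)) (X : L) :
    normSq θ (φ X) = normSq θ X := by
  simp only [normSq, ← hφ, killingForm_of_equiv_apply]

lemma normSq_sum {ι : Type*} (s : Finset ι) (f : ι → L)
    (h : ∀ i ∈ s, ∀ j ∈ s, i ≠ j → killingForm ℂ L (f i) (θ (f j)) = 0) :
    normSq θ (∑ i ∈ s, f i) = ∑ i ∈ s, normSq θ (f i) := by
  have h1 : killingForm ℂ L (∑ i ∈ s, f i) (θ (∑ i ∈ s, f i)) =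
      ∑ i ∈ s, killingForm ℂ L (f i) (θ (f i)) := by
    simp only [hθ.map_sum, _root_.map_sum, LinearMap.sum_apply]
    refine Finset.sum_congr rfl fun j hj => ?_
    exact Finset.sum_eq_single_of_mem j hj fun i hi hij => h i hi j hj hij
  simp only [normSq, h1, Complex.re_sum, Finset.sum_neg_distrib]

/-- The Hermitian form `-κ(θ X, Y)`. -/
@[reducible]
def innerCore : InnerProductSpace.Core ℂ L where
  inner X Y := -killingForm ℂ L Y (θ X)
  conj_inner_symm X Y := by
    rw [_root_.map_neg, ← hθ.killingForm_map, hθ.involutive, LieModule.traceForm_comm]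
  re_inner_nonneg X := hθ.normSq_nonneg X
  add_left X Y Z := by simp [hθ.map_add]; ring
  smul_left X Y c := by simp [hθ.map_smul]
  definite X h := by
    rw [hθ.killingForm_self, neg_neg] at h
    exact hθ.normSq_eq_zero.1 (by exact_mod_cast h)

lemma norm_killingForm_sq_le (X Y : L) :
    ‖killingForm ℂ L X (θ Y)‖ ^ 2 ≤ normSq θ X * normSq θ Y := by
  have h := @InnerProductSpace.Core.inner_mul_inner_self_le ℂ L _ _ _
    hθ.innerCore.toCore Y X
  have h1 : ‖killingForm ℂ L Y (θ X)‖ = ‖killingForm ℂ L X (θ Y)‖ := by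
    rw [← hθ.involutive Y, hθ.killingForm_map, hθ.involutive, LieModule.traceForm_comm,
      RCLike.norm_conj]
  change ‖-killingForm ℂ L X (θ Y)‖ * ‖-killingForm ℂ L Y (θ X)‖ ≤
    normSq θ Y * normSq θ X at h
  rw [norm_neg, norm_neg, h1] at h
  rw [sq, mul_comm (normSq θ X)]
  exact h

lemma isKilling : IsKilling ℂ L := by
  refine ⟨(LieSubmodule.eq_bot_iff _).2 fun X hX => ?_⟩
  rw [LieIdeal.mem_killingCompl] at hX
  have h1 := hX (θ X) (LieSubmodule.mem_top _)
  rw [LieModule.traceForm_comm, hθ.killingForm_self] at h1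
  exact hθ.normSq_eq_zero.1 (by exact_mod_cast neg_eq_zero.1 h1)

end IsCompactConjugation
end CompactConjugation

/-! ### Dominant elements and the highest root. -/

section Dominant

open LieAlgebra LieModule LieAlgebra.IsKilling

variable {L : Type*} [LieRing L] [LieAlgebra ℂ L]

lemma LieAlgebra.lie_eq_zero_or_exists_weight {𝔥 : LieSubalgebra ℂ L} [𝔥.IsCartanSubalgebra]
    {α β : 𝔥 → ℂ} {x y : L} (hx : x ∈ rootSpace 𝔥 α) (hy : y ∈ rootSpace 𝔥 β) :
    ⁅x, y⁆ = 0 ∨ ∃ γ : Weight ℂ 𝔥 L, (γ : 𝔥 → ℂ) = α + β ∧ ⁅x, y⁆ ∈ rootSpace 𝔥 γ := by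
  have h := lie_mem_genWeightSpace_of_mem_genWeightSpace hx hy
  by_cases hb : rootSpace 𝔥 (α + β) = ⊥
  · left
    rw [rootSpace] at hb
    rw [hb] at h
    simpa using h
  · exact Or.inr ⟨⟨α + β, hb⟩, rfl, h⟩

variable [FiniteDimensional ℂ L]

lemma LieAlgebra.eq_top_of_rootSpace_le {𝔥 : LieSubalgebra ℂ L} [𝔥.IsCartanSubalgebra]
    {S : Submodule ℂ L} (h : ∀ α : Weight ℂ 𝔥 L, ∀ x ∈ rootSpace 𝔥 α, x ∈ S) : S = ⊤ := by
  have h1 := LieSubmodule.iSup_toSubmodule_eq_top.mpr (iSup_genWeightSpace_eq_top' ℂ 𝔥 L)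
  rw [eq_top_iff, ← h1]
  exact iSup_le fun α x hx => h α x hx

variable [IsKilling ℂ L]

lemma LieAlgebra.neg_apply_re_le {𝔥 : LieSubalgebra ℂ L} [𝔥.IsCartanSubalgebra]
    (γ : Weight ℂ 𝔥 L) (x : 𝔥) : ((-γ : Weight ℂ 𝔥 L) x).re = -(γ x).re := by
  simp

/-- A root vector of the maximal root generates an ideal under the negative root spaces alone, hence
all of `L`. So every weight arises from `μ` by adding negative roots, none of which increases the
real part at a dominant `h`. -/
lemma LieAlgebra.re_apply_le_of_dominant [IsSimple ℂ L] (𝔥 : LieSubalgebra ℂ L)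
    [𝔥.IsCartanSubalgebra] {μ : Weight ℂ 𝔥 L} (hμ : μ.IsNonZero) {x₀ : 𝔥}
    (h1 : ∀ α : Weight ℂ 𝔥 L, α.IsNonZero → (α x₀).re ≠ 0)
    (h2 : ∀ α : Weight ℂ 𝔥 L, α.IsNonZero → (α x₀).re ≤ (μ x₀).re) {h : 𝔥}
    (hd : ∀ γ : Weight ℂ 𝔥 L, γ.IsNonZero → 0 < (γ x₀).re → 0 ≤ (γ h).re)
    (α : Weight ℂ 𝔥 L) : (α h).re ≤ (μ h).re := by
  have hμ0 : 0 < (μ x₀).re := by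
    have h3 := h2 (-μ) hμ.neg
    rw [neg_apply_re_le] at h3
    exact lt_of_le_of_ne (by linarith) (h1 μ hμ).symm
  obtain ⟨v, hv, hv0⟩ := μ.exists_ne_zero
  let C : Set (Submodule ℂ L) := {W | v ∈ W ∧ ∀ γ : Weight ℂ 𝔥 L, (γ x₀).re < 0 →
    ∀ y ∈ rootSpace 𝔥 γ, ∀ w ∈ W, ⁅y, w⁆ ∈ W}
  let S : Submodule ℂ L := sInf C
  have hvS : v ∈ S := by
    rw [Submodule.mem_sInf]; exact fun W hW => hW.1
  have hSC : ∀ γ : Weight ℂ 𝔥 L, (γ x₀).re < 0 →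
      ∀ y ∈ rootSpace 𝔥 γ, ∀ w ∈ S, ⁅y, w⁆ ∈ S := by
    intro γ hγ y hy w hw
    rw [Submodule.mem_sInf] at hw ⊢
    exact fun W hW => hW.2 γ hγ y hy w (hw W hW)
  -- the subspace generated by `v` under the negative root spaces is an ideal
  have hideal : ∀ w ∈ S, ∀ x : L, ⁅x, w⁆ ∈ S := by
    -- The part of `S` that `L` brackets into `S` again contains `v` and is stable under lowering,
    -- so by minimality it is all of `S`.
    let S' : Submodule ℂ L :=
      { carrier := {w | w ∈ S ∧ ∀ x : L, ⁅x, w⁆ ∈ S}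
        add_mem' := fun {a b} ha hb => ⟨S.add_mem ha.1 hb.1, fun x => by
          rw [lie_add]; exact S.add_mem (ha.2 x) (hb.2 x)⟩
        zero_mem' := ⟨S.zero_mem, fun x => by rw [lie_zero]; exact S.zero_mem⟩
        smul_mem' := fun c a ha => ⟨S.smul_mem c ha.1, fun x => by
          rw [lie_smul]; exact S.smul_mem c (ha.2 x)⟩ }
    have hS' : S' ∈ C := by
      refine ⟨⟨hvS, fun x => ?_⟩, fun γ hγ y hy w hw => ⟨hSC γ hγ y hy w hw.1, fun x => ?_⟩⟩
      · let T : Submodule ℂ L :=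
          { carrier := {x | ⁅x, v⁆ ∈ S}
            add_mem' := fun {a b} ha hb => by
              simp only [Set.mem_ofPred_eq, add_lie] at *; exact S.add_mem ha hb
            zero_mem' := by simp
            smul_mem' := fun c a ha => by
              simp only [Set.mem_ofPred_eq, smul_lie] at *; exact S.smul_mem c ha }
        have hT : T = ⊤ := by
          refine eq_top_of_rootSpace_le (𝔥 := 𝔥) fun β x hx => ?_
          change ⁅x, v⁆ ∈ S
          by_cases hβ : β.IsZero
          · have hx' : x ∈ 𝔥 := by
              rw [hβ.eq, rootSpace_zero_eq] at hx
              exact hx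
            have := lie_eq_smul_of_mem_rootSpace hv ⟨x, hx'⟩
            rw [LieSubalgebra.coe_bracket_of_module] at this
            rw [this]
            exact S.smul_mem _ hvS
          rcases lt_or_gt_of_ne (h1 β hβ) with hn | hp
          · exact hSC β hn x hx v hvS
          -- Raising kills `v`: a weight `β + μ` would be nonzero and larger than `μ` at `x₀`.
          · rcases lie_eq_zero_or_exists_weight hx hv with h0 | ⟨γ, hγ, -⟩
            · rw [h0]; exact S.zero_mem
            · have e : (γ x₀).re = (β x₀).re + (μ x₀).re := by rw [hγ]; simp
              have hγ0 : γ.IsNonZero := by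
                intro h0
                rw [h0.eq] at e
                simp at e
                linarith
              have := h2 γ hγ0
              linarith
        have : x ∈ T := hT ▸ Submodule.mem_top
        exact this
      · rw [leibniz_lie]
        exact S.add_mem (by
          have := hw.2 ⁅x, y⁆
          exact this) (hSC γ hγ y hy _ (hw.2 x))
    have hle : S ≤ S' := sInf_le hS'
    exact fun w hw => (hle hw).2
  have hStop : S = ⊤ := by
    let I : LieIdeal ℂ L := { S with lie_mem := fun {x m} hm => hideal m hm x }
    rcases IsSimple.eq_bot_or_eq_top (R := ℂ) I with hI | hI
    · have : v ∈ I := hvS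
      rw [hI] at this
      exact absurd (by simpa using this) hv0
    · rw [eq_top_iff]
      intro x _
      have : x ∈ I := hI ▸ LieSubmodule.mem_top x
      exact this
  by_contra hlt
  rw [not_le] at hlt
  -- Lowering preserves this sum because `h` is dominant, so it is all of `L`. A weight `α` above
  -- the bound would contradict independence of the weight spaces.
  let T : Submodule ℂ L := ⨆ β : {β : Weight ℂ 𝔥 L // (β h).re ≤ (μ h).re},
    (rootSpace 𝔥 (β : Weight ℂ 𝔥 L)).toSubmodule
  have hT : T ∈ C := by
    refine ⟨?_, fun γ hγ y hy w hw => ?_⟩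
    · exact (le_iSup (fun β : {β : Weight ℂ 𝔥 L // (β h).re ≤ (μ h).re} =>
        (rootSpace 𝔥 (β : Weight ℂ 𝔥 L)).toSubmodule) ⟨μ, le_rfl⟩) hv
    · refine Submodule.iSup_induction _ (motive := fun w => ⁅y, w⁆ ∈ T) hw ?_ (by simp) ?_
      · intro β w hw
        rcases lie_eq_zero_or_exists_weight hy hw with h0 | ⟨δ, hδ, hm⟩
        · rw [h0]; exact T.zero_mem
        · have hγ0 : γ.IsNonZero := by
            intro h0
            rw [h0.eq] at hγ
            simp at hγ
          have h3 := hd (-γ) hγ0.neg (by rw [neg_apply_re_le]; linarith)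
          rw [neg_apply_re_le] at h3
          have hδ' : (δ h).re ≤ (μ h).re := by
            have := β.2
            rw [hδ]; simp; linarith
          exact (le_iSup (fun β : {β : Weight ℂ 𝔥 L // (β h).re ≤ (μ h).re} =>
            (rootSpace 𝔥 (β : Weight ℂ 𝔥 L)).toSubmodule) ⟨δ, hδ'⟩) hm
      · intro a b ha hb
        rw [lie_add]; exact T.add_mem ha hb
  have hTtop : T = ⊤ := by
    rw [eq_top_iff, ← hStop]; exact sInf_le hT
  have hind := LieSubmodule.iSupIndep_toSubmodule.mpr (iSupIndep_genWeightSpace' ℂ 𝔥 L)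
  have hdis := hind α
  have hTle : T ≤ ⨆ j, ⨆ (_ : j ≠ α), (genWeightSpace L (j : 𝔥 → ℂ)).toSubmodule := by
    refine iSup_le fun β => ?_
    refine le_iSup₂_of_le β.1 ?_ le_rfl
    rintro h0
    have := β.2
    rw [h0] at this
    linarith
  rw [hTtop, top_le_iff] at hTle
  rw [hTle, disjoint_top] at hdis
  have h0 : genWeightSpace L (α : 𝔥 → ℂ) = ⊥ := by simpa using hdis
  exact α.2 h0

end Dominant

/-! ### Root lengths for the Killing form. -/

section CompactConjugation

open LieAlgebra LieModule LieAlgebra.IsKilling ComplexConjugate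

variable {L : Type*} [LieRing L] [LieAlgebra ℂ L] [FiniteDimensional ℂ L] [IsKilling ℂ L]
  {𝔥 : LieSubalgebra ℂ L} [𝔥.IsCartanSubalgebra]

/-- The vector of the Cartan subalgebra that is dual to a root for the Killing form. -/
def rootVec (α : Weight ℂ 𝔥 L) : 𝔥 := (cartanEquivDual 𝔥).symm α.toLinear

lemma killingForm_rootVec (α : Weight ℂ 𝔥 L) (h : 𝔥) :
    killingForm ℂ L (rootVec α) h = α h := by
  have h1 : cartanEquivDual 𝔥 (rootVec α) h = Weight.toLinear ℂ 𝔥 L α h := by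
    rw [rootVec, LinearEquiv.apply_symm_apply]
  exact h1

lemma eq_of_killingForm_cartan {s t : 𝔥} (h : ∀ x : 𝔥, killingForm ℂ L s x = killingForm ℂ L t x) :
    s = t := by
  apply (cartanEquivDual 𝔥).injective
  ext x
  exact h x

lemma apply_rootVec_comm (α β : Weight ℂ 𝔥 L) : α (rootVec β) = β (rootVec α) := by
  rw [← killingForm_rootVec, ← killingForm_rootVec, LieModule.traceForm_comm]

lemma rootVec_reflectRoot (α β : Weight ℂ 𝔥 L) :
    rootVec (reflectRoot α β) = rootVec β - β (coroot α) • rootVec α := by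
  apply eq_of_killingForm_cartan
  intro x
  rw [killingForm_rootVec]
  have h1 : ((rootVec β - β (coroot α) • rootVec α : 𝔥) : L) =
    (rootVec β : L) - β (coroot α) • (rootVec α : L) := rfl
  rw [h1, _root_.map_sub, _root_.map_smul, LinearMap.sub_apply, LinearMap.smul_apply,
    killingForm_rootVec, killingForm_rootVec]
  rfl

lemma apply_coroot_mul {α : Weight ℂ 𝔥 L} (hα : α.IsNonZero) (β : Weight ℂ 𝔥 L) :
    β (coroot α) * α (rootVec α) = 2 * β (rootVec α) := by
  have h0 := root_apply_cartanEquivDual_symm_ne_zero hα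
  change α (rootVec α) ≠ 0 at h0
  have h1 : coroot α = (2 * (α (rootVec α))⁻¹) • rootVec α := by
    rw [coroot, two_smul, mul_smul, two_smul]; rfl
  rw [h1, ← Weight.toLinear_apply, _root_.map_smul, Weight.toLinear_apply, smul_eq_mul]
  field_simp

lemma reflectRoot_apply_rootVec {α : Weight ℂ 𝔥 L} (hα : α.IsNonZero) (β : Weight ℂ 𝔥 L) :
    (reflectRoot α β) (rootVec (reflectRoot α β)) = β (rootVec β) := by
  rw [rootVec_reflectRoot]
  have h1 : ∀ x : 𝔥, (reflectRoot α β) x = β x - β (coroot α) * α x := fun x => rfl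
  have h2 := apply_coroot_mul hα β
  rw [h1, ← Weight.toLinear_apply, ← Weight.toLinear_apply, _root_.map_sub, _root_.map_sub,
    _root_.map_smul, _root_.map_smul]
  simp only [Weight.toLinear_apply, smul_eq_mul]
  rw [apply_rootVec_comm α β]
  linear_combination β (coroot α) * h2

/-- A root that is largest among the roots of its length is dominant. -/
lemma re_apply_rootVec_nonneg {β : Weight ℂ 𝔥 L} (hβ : β.IsNonZero) {x₀ : 𝔥}
    (hmax : ∀ α : Weight ℂ 𝔥 L, α.IsNonZero → α (rootVec α) = β (rootVec β) →
      (α x₀).re ≤ (β x₀).re)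
    (hpos : ∀ α : Weight ℂ 𝔥 L, α.IsNonZero → 0 < (α (rootVec α)).re)
    {γ : Weight ℂ 𝔥 L} (hγ : γ.IsNonZero) (hγ0 : 0 < (γ x₀).re) :
    0 ≤ (γ (rootVec β)).re := by
  -- The reflected root `β - n γ` has the length of `β`, so it is not larger at `x₀`. As `γ` is
  -- positive there, the Cartan integer `n` is nonnegative, and it has the sign of the pairing of
  -- `β` and `γ`.
  have h1 := hmax (reflectRoot γ β) (reflectRoot_isNonZero γ β hβ)
    (reflectRoot_apply_rootVec hγ β)
  have h2 : (reflectRoot γ β) x₀ = β x₀ - β (coroot γ) * γ x₀ := rfl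
  have h3 := apply_coroot_eq_cast γ β
  have h4 := apply_coroot_mul hγ β
  set n : ℤ := chainBotCoeff γ β - chainTopCoeff γ β
  rw [h3] at h2 h4
  have h5 : 0 ≤ (n : ℝ) := by
    rw [h2] at h1
    have e : ((n : ℂ) * γ x₀).re = n * (γ x₀).re := by
      rw [← Complex.ofReal_intCast, Complex.re_ofReal_mul]
    rw [Complex.sub_re, e] at h1
    by_contra hn
    nlinarith
  have h6 := congrArg Complex.re h4
  rw [← Complex.ofReal_intCast, Complex.re_ofReal_mul,
    show (2 : ℂ) = ((2 : ℝ) : ℂ) by norm_num, Complex.re_ofReal_mul] at h6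
  rw [apply_rootVec_comm γ β]
  have := mul_nonneg h5 (hpos γ hγ).le
  linarith

/-- The maximal root is a longest root. -/
lemma re_apply_rootVec_le_of_isMaximalRoot [IsSimple ℂ L] {μ : Weight ℂ 𝔥 L}
    (hμ : IsMaximalRoot 𝔥 μ)
    (hpos : ∀ α : Weight ℂ 𝔥 L, α.IsNonZero → 0 < (α (rootVec α)).re)
    {α : Weight ℂ 𝔥 L} (hα : α.IsNonZero) : (α (rootVec α)).re ≤ (μ (rootVec μ)).re := by
  obtain ⟨hμ0, x₀, h1, h2⟩ := hμ
  -- Replace `α` by the largest root `β` of its length. Both `β` and `μ` are dominant, so `⟨β, β⟩ ≤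
  -- ⟨μ, β⟩ ≤ ⟨μ, μ⟩`.
  obtain ⟨β, ⟨hβ0, hβα⟩, hβ⟩ := Set.exists_max_image
    {β : Weight ℂ 𝔥 L | β.IsNonZero ∧ β (rootVec β) = α (rootVec α)} (fun β => (β x₀).re)
    (Set.toFinite _) ⟨α, hα, rfl⟩
  have hβd : ∀ γ : Weight ℂ 𝔥 L, γ.IsNonZero → 0 < (γ x₀).re → 0 ≤ (γ (rootVec β)).re :=
    fun γ hγ hγ0 => re_apply_rootVec_nonneg hβ0
      (fun δ hδ hδβ => hβ δ ⟨hδ, hδβ.trans hβα⟩) hpos hγ hγ0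
  have hμd : ∀ γ : Weight ℂ 𝔥 L, γ.IsNonZero → 0 < (γ x₀).re → 0 ≤ (γ (rootVec μ)).re :=
    fun γ hγ hγ0 => re_apply_rootVec_nonneg hμ0 (fun δ hδ _ => h2 δ hδ) hpos hγ hγ0
  have h3 := re_apply_le_of_dominant 𝔥 hμ0 h1 h2 hβd β
  have h4 := re_apply_le_of_dominant 𝔥 hμ0 h1 h2 hμd β
  rw [apply_rootVec_comm β μ] at h4
  rw [hβα] at h3
  linarith

end CompactConjugation

/-! ### The sharp bound on `ad X`. -/

section CompactConjugation

open LieAlgebra LieModule LieAlgebra.IsKilling ComplexConjugate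

variable {L : Type*} [LieRing L] [LieAlgebra ℂ L]

lemma killingForm_lie_left (X Y Z : L) :
    killingForm ℂ L ⁅X, Y⁆ Z = -killingForm ℂ L Y ⁅X, Z⁆ := by
  rw [← lie_skew, _root_.map_neg, LinearMap.neg_apply, LieModule.traceForm_apply_lie_apply]

variable [FiniteDimensional ℂ L] {𝔥 : LieSubalgebra ℂ L} [𝔥.IsCartanSubalgebra]

lemma exists_sum_rootSpace [Fintype (Weight ℂ 𝔥 L)] (Y : L) :
    ∃ y : Weight ℂ 𝔥 L → L, (∀ α : Weight ℂ 𝔥 L, y α ∈ rootSpace 𝔥 α) ∧ ∑ α, y α = Y := by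
  have h1 := LieSubmodule.iSup_toSubmodule_eq_top.mpr (iSup_genWeightSpace_eq_top' ℂ 𝔥 L)
  have h2 : Y ∈ ⨆ α : Weight ℂ 𝔥 L, (rootSpace 𝔥 α).toSubmodule := h1 ▸ Submodule.mem_top
  rw [Submodule.mem_iSup_iff_exists_finsupp] at h2
  obtain ⟨f, hf, hs⟩ := h2
  exact ⟨f, hf, by rw [← hs, Finsupp.sum_fintype _ _ fun _ => rfl]⟩

variable [IsKilling ℂ L]

lemma lie_rootSpace {α : 𝔥 → ℂ} {v : L} (hv : v ∈ rootSpace 𝔥 α) {h : L} (hh : h ∈ 𝔥) :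
    ⁅h, v⁆ = α ⟨h, hh⟩ • v := lie_eq_smul_of_mem_rootSpace hv ⟨h, hh⟩

namespace IsCompactConjugation

variable {θ : L → L} (hθ : IsCompactConjugation θ) (hs : ∀ h ∈ 𝔥, θ h ∈ 𝔥)

include hθ

/-- The adjoint of `ad h` for the Hermitian form is `-ad (θ h)`; evaluate both on a root vector. -/
lemma weight_apply_map (α : Weight ℂ 𝔥 L) (h : 𝔥) :
    α ⟨θ h, hs h h.2⟩ = -conj (α h) := by
  obtain ⟨v, hv, hv0⟩ := α.exists_ne_zero
  have h1 := lie_rootSpace hv h.2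
  have h2 : ⁅(h : L), θ v⁆ = conj (α ⟨θ h, hs h h.2⟩) • θ v := by
    rw [← hθ.map_smul, ← lie_rootSpace hv (hs h h.2), hθ.map_lie, hθ.involutive]
  have h3 := killingForm_lie_left (h : L) v (θ v)
  rw [h1, h2, _root_.map_smul, _root_.map_smul, LinearMap.smul_apply, hθ.killingForm_self] at h3
  have h4 : (normSq θ v : ℂ) ≠ 0 := by exact_mod_cast (hθ.normSq_pos hv0).ne'
  have h5 : α h = -conj (α ⟨θ h, hs h h.2⟩) := by
    simp only [smul_eq_mul] at h3
    apply mul_right_cancel₀ (neg_ne_zero.2 h4)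
    simpa using h3
  rw [h5]
  simp

include hs in
lemma map_mem_rootSpace {α : Weight ℂ 𝔥 L} {v : L} (hv : v ∈ rootSpace 𝔥 α) :
    θ v ∈ rootSpace 𝔥 (-α : 𝔥 → ℂ) := by
  refine weightSpace_le_genWeightSpace L (-α : 𝔥 → ℂ) ?_
  rw [mem_weightSpace]
  intro h
  have h1 := lie_rootSpace hv (hs h h.2)
  have h2 : ⁅(h : L), θ v⁆ = conj (α ⟨θ h, hs h h.2⟩) • θ v := by
    rw [← hθ.map_smul, ← h1, hθ.map_lie, hθ.involutive]
  rw [hθ.weight_apply_map hs] at h2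
  rw [LieSubalgebra.coe_bracket_of_module, h2]
  simp

include hs in
lemma map_rootVec (α : Weight ℂ 𝔥 L) : θ (rootVec α : 𝔥) = -(rootVec α : L) := by
  have h1 : (⟨θ (rootVec α : 𝔥), hs _ (rootVec α).2⟩ : 𝔥) = -rootVec α := by
    apply eq_of_killingForm_cartan
    intro x
    have h2 := hθ.killingForm_map (rootVec α : 𝔥) (θ x)
    rw [hθ.involutive] at h2
    have h3 := killingForm_rootVec α ⟨θ x, hs x x.2⟩
    change killingForm ℂ L (θ (rootVec α : 𝔥)) x = killingForm ℂ L (-(rootVec α : L)) x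
    rw [_root_.map_neg, LinearMap.neg_apply, killingForm_rootVec, h2]
    change killingForm ℂ L (rootVec α : 𝔥) (θ x) = _ at h3
    rw [h3, hθ.weight_apply_map hs]
    simp
  exact congrArg Subtype.val h1

include hs in
lemma apply_rootVec_self (α : Weight ℂ 𝔥 L) :
    α (rootVec α) = normSq θ (rootVec α : L) := by
  have h1 := hθ.killingForm_self (rootVec α : L)
  rw [hθ.map_rootVec hs, _root_.map_neg, killingForm_rootVec] at h1
  exact neg_injective h1

lemma normSq_rootVec_pos {α : Weight ℂ 𝔥 L} (hα : α.IsNonZero) :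
    0 < normSq θ (rootVec α : L) := by
  refine hθ.normSq_pos fun h0 => hα ?_
  ext x
  rw [← killingForm_rootVec, h0]
  simp

include hs in
lemma killingForm_map_rootSpace {α β : Weight ℂ 𝔥 L} (hαβ : α ≠ β) {x y : L}
    (hx : x ∈ rootSpace 𝔥 α) (hy : y ∈ rootSpace 𝔥 β) : killingForm ℂ L x (θ y) = 0 := by
  refine killingForm_apply_eq_zero_of_mem_rootSpace_of_add_ne_zero ℂ L 𝔥 hx
    (hθ.map_mem_rootSpace hs hy) fun h0 => hαβ ?_
  ext z
  have := congrFun h0 z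
  simp only [Pi.add_apply, Pi.neg_apply, Pi.zero_apply] at this
  linear_combination this

include hs in
lemma normSq_sum_rootSpace [Fintype (Weight ℂ 𝔥 L)] {y : Weight ℂ 𝔥 L → L}
    (hy : ∀ α : Weight ℂ 𝔥 L, y α ∈ rootSpace 𝔥 α) : normSq θ (∑ α, y α) = ∑ α, normSq θ (y α) :=
  hθ.normSq_sum _ _ fun α _ β _ hαβ => hθ.killingForm_map_rootSpace hs hαβ (hy α) (hy β)

include hs in
lemma normSq_lie_sum_rootSpace [Fintype (Weight ℂ 𝔥 L)] {y : Weight ℂ 𝔥 L → L}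
    (hy : ∀ α : Weight ℂ 𝔥 L, y α ∈ rootSpace 𝔥 α) (X : 𝔥) :
    normSq θ ⁅(X : L), ∑ α, y α⁆ = ∑ α, Complex.normSq (α X) * normSq θ (y α) := by
  have h1 : ⁅(X : L), ∑ α, y α⁆ = ∑ α : Weight ℂ 𝔥 L, α X • y α := by
    rw [lie_sum]
    exact Finset.sum_congr rfl fun α _ => lie_rootSpace (hy α) X.2
  rw [h1, hθ.normSq_sum_rootSpace hs fun α => (rootSpace 𝔥 α).smul_mem _ (hy α)]
  exact Finset.sum_congr rfl fun α _ => hθ.normSq_smul _ _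

lemma normSq_weight_apply_le (α : Weight ℂ 𝔥 L) {X : 𝔥} (hX : θ X = X) :
    Complex.normSq (α X) ≤ normSq θ (rootVec α : L) * normSq θ (X : L) := by
  have h1 := hθ.norm_killingForm_sq_le (rootVec α : L) (X : L)
  rwa [hX, killingForm_rootVec, ← Complex.normSq_eq_norm_sq] at h1

include hs in
lemma normSq_rootVec_le [IsSimple ℂ L] {μ : Weight ℂ 𝔥 L} (hμ : IsMaximalRoot 𝔥 μ)
    {α : Weight ℂ 𝔥 L} (hα : α.IsNonZero) :
    normSq θ (rootVec α : L) ≤ normSq θ (rootVec μ : L) := by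
  have := re_apply_rootVec_le_of_isMaximalRoot hμ (fun β hβ => by
    rw [hθ.apply_rootVec_self hs]; exact_mod_cast hθ.normSq_rootVec_pos hβ) hα
  rw [hθ.apply_rootVec_self hs, hθ.apply_rootVec_self hs] at this
  exact_mod_cast this

include hs in
lemma normSq_lie_le_of_mem_cartan [IsSimple ℂ L] {μ : Weight ℂ 𝔥 L} (hμ : IsMaximalRoot 𝔥 μ)
    {X : 𝔥} (hX : θ X = X) (Y : L) :
    normSq θ ⁅(X : L), Y⁆ ≤ normSq θ (rootVec μ : L) * normSq θ (X : L) * normSq θ Y := by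
  have := Fintype.ofFinite (Weight ℂ 𝔥 L)
  obtain ⟨y, hy, rfl⟩ := exists_sum_rootSpace (𝔥 := 𝔥) Y
  rw [hθ.normSq_lie_sum_rootSpace hs hy, hθ.normSq_sum_rootSpace hs hy, Finset.mul_sum]
  refine Finset.sum_le_sum fun α _ => mul_le_mul_of_nonneg_right ?_ (hθ.normSq_nonneg _)
  by_cases hα : α.IsZero
  · rw [hα.eq]
    simpa using mul_nonneg (hθ.normSq_nonneg _) (hθ.normSq_nonneg _)
  · exact (hθ.normSq_weight_apply_le α hX).trans
      (mul_le_mul_of_nonneg_right (hθ.normSq_rootVec_le hs hμ hα) (hθ.normSq_nonneg _))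

include hs in
/-- Each fixed vector of the conjugation is conjugate to a vector of the Cartan subalgebra. -/
lemma exists_equiv_mem_cartan {μ : Weight ℂ 𝔥 L} (hμ : IsMaximalRoot 𝔥 μ) {X : L}
    (hX : θ X = X) : ∃ φ : L ≃ₗ⁅ℂ⁆ L, (∀ Y, φ (θ Y) = θ (φ Y)) ∧ φ X ∈ 𝔥 := by
  obtain ⟨-, x₀, h1, -⟩ := hμ
  -- This is fixed by `θ`, and each root takes the value `2i Re α(x₀)` on it, which is nonzero. Thus
  -- `a` is regular in `𝔥`.
  let a : 𝔥 := Complex.I • (x₀ - ⟨θ x₀, hs _ x₀.2⟩)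
  have ha : θ (a : L) = a := by
    change θ (Complex.I • ((x₀ : L) - θ x₀)) = Complex.I • ((x₀ : L) - θ x₀)
    rw [hθ.map_smul, hθ.map_sub, hθ.involutive, Complex.conj_I, neg_smul, ← smul_neg, neg_sub]
  have ha0 : ∀ α : Weight ℂ 𝔥 L, α.IsNonZero → α a ≠ 0 := by
    intro α hα
    have : α a = Complex.I * (α x₀ - α ⟨θ x₀, hs _ x₀.2⟩) := by
      rw [← Weight.toLinear_apply, ← Weight.toLinear_apply, ← Weight.toLinear_apply,
        ← _root_.map_sub, ← smul_eq_mul, ← _root_.map_smul]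
    rw [this, hθ.weight_apply_map hs, sub_neg_eq_add, Complex.add_conj]
    simpa using h1 α hα
  obtain ⟨φ, hφ, hφa⟩ := hθ.exists_conj a X ha hX
  refine ⟨φ, hφ, ?_⟩
  have := Fintype.ofFinite (Weight ℂ 𝔥 L)
  obtain ⟨y, hy, hyX⟩ := exists_sum_rootSpace (𝔥 := 𝔥) (φ X)
  -- The norm is the sum of the terms `|α(a)|² normSq (y α)`, so every component outside `𝔥`
  -- vanishes.
  have h2 : normSq θ ⁅(a : L), φ X⁆ = 0 := by
    rw [← lie_skew, hφa, neg_zero, normSq_zero]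
  rw [← hyX, hθ.normSq_lie_sum_rootSpace hs hy, Finset.sum_eq_zero_iff_of_nonneg
    fun α _ => mul_nonneg (Complex.normSq_nonneg _) (hθ.normSq_nonneg _)] at h2
  rw [← hyX]
  refine Submodule.sum_mem 𝔥.toSubmodule fun α _ => ?_
  by_cases hα : α.IsZero
  · have := hy α
    rw [hα.eq, rootSpace_zero_eq] at this
    exact this
  · rcases mul_eq_zero.1 (h2 α (Finset.mem_univ _)) with h3 | h3
    · exact absurd (Complex.normSq_eq_zero.1 h3) (ha0 α hα)
    · rw [hθ.normSq_eq_zero.1 h3]; exact 𝔥.zero_mem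

include hs in
lemma normSq_lie_le_of_map_eq [IsSimple ℂ L] {μ : Weight ℂ 𝔥 L} (hμ : IsMaximalRoot 𝔥 μ)
    {X : L} (hX : θ X = X) (Y : L) :
    normSq θ ⁅X, Y⁆ ≤ normSq θ (rootVec μ : L) * normSq θ X * normSq θ Y := by
  obtain ⟨φ, hφ, hφX⟩ := hθ.exists_equiv_mem_cartan hs hμ hX
  rw [← normSq_equiv φ hφ, LieEquiv.map_lie, ← normSq_equiv φ hφ X, ← normSq_equiv φ hφ Y]
  exact hθ.normSq_lie_le_of_mem_cartan hs hμ (X := ⟨φ X, hφX⟩) (by rw [← hφ, hX]) _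

include hs in
lemma normSq_lie_le_of_map_eq_neg [IsSimple ℂ L] {μ : Weight ℂ 𝔥 L} (hμ : IsMaximalRoot 𝔥 μ)
    {X : L} (hX : θ X = -X) (Y : L) :
    normSq θ ⁅X, Y⁆ ≤ normSq θ (rootVec μ : L) * normSq θ X * normSq θ Y := by
  have h1 := hθ.normSq_lie_le_of_map_eq hs hμ (X := Complex.I • X)
    (by rw [hθ.map_smul, hX, Complex.conj_I, neg_smul, smul_neg, neg_neg]) Y
  rwa [smul_lie, hθ.normSq_smul, hθ.normSq_smul, Complex.normSq_I, one_mul, one_mul] at h1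

/-- Apply the bound obtained from `𝔥'` to `ad t_μ` acting on a root vector of `μ`. The eigenvalue is
`M`, so `M² ≤ M' M`. -/
lemma normSq_rootVec_unique [IsSimple ℂ L] {𝔥' : LieSubalgebra ℂ L} [𝔥'.IsCartanSubalgebra]
    (hs : ∀ h ∈ 𝔥, θ h ∈ 𝔥) (hs' : ∀ h ∈ 𝔥', θ h ∈ 𝔥')
    {μ : Weight ℂ 𝔥 L} (hμ : IsMaximalRoot 𝔥 μ) {μ' : Weight ℂ 𝔥' L}
    (hμ' : IsMaximalRoot 𝔥' μ') :
    normSq θ (rootVec μ : L) ≤ normSq θ (rootVec μ' : L) := by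
  obtain ⟨v, hv, hv0⟩ := μ.exists_ne_zero
  have h1 := hθ.normSq_lie_le_of_map_eq_neg hs' hμ' (hθ.map_rootVec hs μ) v
  rw [lie_rootSpace hv (rootVec μ).2, hθ.normSq_smul] at h1
  change Complex.normSq (μ (rootVec μ)) * _ ≤ _ at h1
  rw [hθ.apply_rootVec_self hs, Complex.normSq_ofReal] at h1
  have h2 := le_of_mul_le_mul_right h1 (hθ.normSq_pos hv0)
  exact le_of_mul_le_mul_right h2 (hθ.normSq_rootVec_pos hμ.1)

end IsCompactConjugation
end CompactConjugation

/-! ### Existence of a stable Cartan subalgebra, and the normalization. -/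

section CompactConjugation

open LieAlgebra LieModule LieAlgebra.IsKilling ComplexConjugate

/-- The centralizer of an element of a Lie algebra. -/
def elementCentralizer {L : Type*} [LieRing L] [LieAlgebra ℂ L] (x : L) : LieSubalgebra ℂ L where
  carrier := {Y | ⁅x, Y⁆ = 0}
  add_mem' {a b} ha hb := by
    simp only [Set.mem_ofPred_eq, lie_add] at *; rw [ha, hb, add_zero]
  zero_mem' := lie_zero x
  smul_mem' c a ha := by
    simp only [Set.mem_ofPred_eq, lie_smul] at *; rw [ha, smul_zero]
  lie_mem' {a b} ha hb := by
    simp only [Set.mem_ofPred_eq] at *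
    change ⁅x, a⁆ = 0 at ha
    change ⁅x, b⁆ = 0 at hb
    rw [leibniz_lie, ha, hb, zero_lie, lie_zero, add_zero]

lemma mem_elementCentralizer {L : Type*} [LieRing L] [LieAlgebra ℂ L] {x Y : L} :
    Y ∈ elementCentralizer x ↔ ⁅x, Y⁆ = 0 := Iff.rfl

variable {L : Type*} [LieRing L] [LieAlgebra ℂ L]

namespace IsCompactConjugation

variable {θ : L → L} (hθ : IsCompactConjugation θ)

include hθ

/-- If `z` normalizes the centralizer, then `[x, [x, z]] = 0`; since `ad x` is skew-Hermitian,
already `[x, z] = 0`. -/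
lemma isCartanSubalgebra_elementCentralizer {x : L} (hx : θ x = x)
    (hab : ∀ Y Z : L, ⁅x, Y⁆ = 0 → ⁅x, Z⁆ = 0 → ⁅Y, Z⁆ = 0) :
    (elementCentralizer x).IsCartanSubalgebra := by
  have hA : IsLieAbelian (elementCentralizer x) :=
    ⟨fun a b => Subtype.ext (hab a b a.2 b.2)⟩
  refine ⟨inferInstance, le_antisymm (fun z hz => ?_) (LieSubalgebra.le_normalizer _)⟩
  rw [LieSubalgebra.mem_normalizer_iff] at hz
  have h1 : ⁅x, ⁅x, z⁆⁆ = 0 := by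
    have := hz x (mem_elementCentralizer.2 (lie_self x))
    rw [mem_elementCentralizer] at this
    rw [← lie_skew x z, lie_neg, this, neg_zero]
  have h2 : killingForm ℂ L ⁅x, z⁆ (θ ⁅x, z⁆) = 0 := by
    rw [killingForm_lie_left, ← hx, ← hθ.map_lie, hx, h1, hθ.map_zero, _root_.map_zero, neg_zero]
  rw [hθ.killingForm_self] at h2
  exact hθ.normSq_eq_zero.1 (by exact_mod_cast neg_eq_zero.1 h2)

variable [FiniteDimensional ℂ L] [IsKilling ℂ L] [IsSimple ℂ L]

lemma exists_isMaximalRoot : ∃ (𝔥 : LieSubalgebra ℂ L) (_ : 𝔥.IsCartanSubalgebra)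
    (μ : Weight ℂ 𝔥 L), (∀ h ∈ 𝔥, θ h ∈ 𝔥) ∧ IsMaximalRoot 𝔥 μ := by
  obtain ⟨x, hx, hab⟩ := hθ.exists_regular
  have hC := hθ.isCartanSubalgebra_elementCentralizer hx hab
  set 𝔥 := elementCentralizer x
  have hs : ∀ h ∈ 𝔥, θ h ∈ 𝔥 := by
    intro h hh
    rw [mem_elementCentralizer] at hh ⊢
    rw [← hx, ← hθ.map_lie, hh, hθ.map_zero]
  have hx𝔥 : x ∈ 𝔥 := mem_elementCentralizer.2 (lie_self x)
  have hne : ∃ α : Weight ℂ 𝔥 L, α.IsNonZero := by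
    by_contra! h0
    have htop : ∀ Y : L, Y ∈ 𝔥 := by
      intro Y
      have := Fintype.ofFinite (Weight ℂ 𝔥 L)
      obtain ⟨y, hy, rfl⟩ := exists_sum_rootSpace (𝔥 := 𝔥) Y
      refine Submodule.sum_mem 𝔥.toSubmodule fun α _ => ?_
      have h1 := hy α
      rw [(h0 α).eq, rootSpace_zero_eq] at h1
      exact h1
    exact IsSimple.non_abelian ℂ (L := L) ⟨fun a b => hab a b (htop a) (htop b)⟩
  -- Roots are imaginary on the fixed vector `x`, so `i x` can define the ordering. A root vanishing
  -- at `x` would have its root vectors in the abelian `𝔥` and so be zero.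
  have hre : ∀ α : Weight ℂ 𝔥 L, α.IsNonZero → (α (Complex.I • ⟨x, hx𝔥⟩)).re ≠ 0 := by
    intro α hα h0
    have h1 : α (Complex.I • ⟨x, hx𝔥⟩) = Complex.I * α ⟨x, hx𝔥⟩ := by
      rw [← Weight.toLinear_apply, _root_.map_smul]; rfl
    have h2 := hθ.weight_apply_map hs α ⟨x, hx𝔥⟩
    have h3 : α ⟨x, hx𝔥⟩ = -conj (α ⟨x, hx𝔥⟩) := by
      rw [← h2]; congr 1; exact Subtype.ext hx.symm
    have h4 : α ⟨x, hx𝔥⟩ = 0 := by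
      apply Complex.ext
      · have := congrArg Complex.re h3
        simp at this ⊢
        linarith
      · rw [h1] at h0
        simpa using h0
    obtain ⟨v, hv, hv0⟩ := α.exists_ne_zero
    have h5 : v ∈ 𝔥 := by
      rw [mem_elementCentralizer, lie_rootSpace hv hx𝔥, h4, zero_smul]
    refine hα ?_
    ext h
    have h6 := lie_rootSpace hv h.2
    rw [hab h v h.2 h5] at h6
    exact (smul_eq_zero.1 h6.symm).resolve_right hv0
  obtain ⟨μ, hμ, hmax⟩ := Set.exists_max_image {α : Weight ℂ 𝔥 L | α.IsNonZero}
    (fun α => (α (Complex.I • ⟨x, hx𝔥⟩)).re) (Set.toFinite _) hne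
  exact ⟨𝔥, hC, μ, hs, hμ, _, hre, hmax⟩

omit hθ [IsSimple ℂ L] in
lemma smul_eq_rootVec {𝔥 : LieSubalgebra ℂ L} [𝔥.IsCartanSubalgebra] {μ : Weight ℂ 𝔥 L}
    {c : ℂ} {t : 𝔥} (ht : IsDualVector (c • killingForm ℂ L) 𝔥 μ t) : c • t = rootVec μ := by
  apply eq_of_killingForm_cartan
  intro h
  rw [killingForm_rootVec, ← ht h]
  change killingForm ℂ L (c • (t : L)) h = _
  simp

lemma isRenormalizedKillingForm_iff {𝔥 : LieSubalgebra ℂ L} [𝔥.IsCartanSubalgebra]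
    (hs : ∀ h ∈ 𝔥, θ h ∈ 𝔥) {μ : Weight ℂ 𝔥 L} (hμ : IsMaximalRoot 𝔥 μ)
    {B : LinearMap.BilinForm ℂ L} : IsRenormalizedKillingForm θ B ↔
      B = ((normSq θ (rootVec μ : L) / 2 : ℝ) : ℂ) • killingForm ℂ L := by
  have hM := hθ.normSq_rootVec_pos hμ.1
  constructor
  · rintro ⟨⟨c, rfl⟩, 𝔥', _, μ', t, hs', hμ', ht, htt⟩
    have h1 := smul_eq_rootVec ht
    have h2 : (c : ℂ) * μ' t = normSq θ (rootVec μ' : L) := by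
      rw [← hθ.apply_rootVec_self hs' μ', ← h1, ← Weight.toLinear_apply, ← Weight.toLinear_apply,
        _root_.map_smul, smul_eq_mul]
    rw [ht t] at htt
    rw [htt, le_antisymm (hθ.normSq_rootVec_unique hs' hs hμ' hμ)
      (hθ.normSq_rootVec_unique hs hs' hμ hμ')] at h2
    have h3 : c = normSq θ (rootVec μ : L) / 2 := by
      have : c * 2 = normSq θ (rootVec μ : L) := by exact_mod_cast h2
      linarith
    rw [h3]
  · rintro rfl
    set M := normSq θ (rootVec μ : L)
    have hM0 : (M : ℂ) ≠ 0 := by exact_mod_cast hM.ne'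
    have key : ∀ h : 𝔥, killingForm ℂ L (((2 / M : ℂ) • rootVec μ : 𝔥) : L) h = 2 / M * μ h := by
      intro h
      change killingForm ℂ L ((2 / M : ℂ) • (rootVec μ : L)) h = _
      rw [_root_.map_smul, LinearMap.smul_apply, killingForm_rootVec, smul_eq_mul]
    have hd : IsDualVector (((M / 2 : ℝ) : ℂ) • killingForm ℂ L) 𝔥 μ ((2 / M : ℂ) • rootVec μ) := by
      intro h
      rw [LinearMap.smul_apply, LinearMap.smul_apply, key, smul_eq_mul]
      push_cast
      field_simp
    refine ⟨⟨_, rfl⟩, 𝔥, inferInstance, μ, (2 / M : ℂ) • rootVec μ, hs, hμ, hd, ?_⟩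
    rw [hd, ← Weight.toLinear_apply, _root_.map_smul, Weight.toLinear_apply,
      hθ.apply_rootVec_self hs, smul_eq_mul]
    exact div_mul_cancel₀ _ hM0

omit hθ [FiniteDimensional ℂ L] [IsKilling ℂ L] [IsSimple ℂ L] in
lemma formLength_cartanInner (c : ℝ) (X : L) :
    formLength (cartanInner ((c : ℂ) • killingForm ℂ L) θ) X = √(c * normSq θ X) := by
  rw [formLength, cartanInner, LinearMap.smul_apply, LinearMap.smul_apply, smul_eq_mul,
    Complex.re_ofReal_mul, normSq, mul_neg]

omit hθ [FiniteDimensional ℂ L] [IsKilling ℂ L] [IsSimple ℂ L] in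
lemma formLength_eq_one_iff {c : ℝ} {X : L} :
    formLength (cartanInner ((c : ℂ) • killingForm ℂ L) θ) X = 1 ↔ c * normSq θ X = 1 := by
  rw [formLength_cartanInner, Real.sqrt_eq_one]

omit hθ [FiniteDimensional ℂ L] [IsKilling ℂ L] [IsSimple ℂ L] in
-- The pair `X₀, Y₀` attains the bound. It also shows that the sets are nonempty, while the bound
-- makes them bounded above; without both, a real `sSup` carries no information.
lemma wangConstant_eq {S : Set L} {M : ℝ} (hM : 0 < M)
    (hS : ∀ X ∈ S, ∀ Y, normSq θ ⁅X, Y⁆ ≤ M * normSq θ X * normSq θ Y) {X₀ Y₀ : L}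
    (hX₀ : X₀ ∈ S) (hX₁ : M / 2 * normSq θ X₀ = 1) (hY₁ : M / 2 * normSq θ Y₀ = 1)
    (h0 : M / 2 * normSq θ ⁅X₀, Y₀⁆ = 2) :
    wangConstant (cartanInner (((M / 2 : ℝ) : ℂ) • killingForm ℂ L) θ) S = √2 := by
  have hb : ∀ X ∈ S, M / 2 * normSq θ X = 1 → ∀ Y, M / 2 * normSq θ Y = 1 →
      √(M / 2 * normSq θ ⁅X, Y⁆) ≤ √2 := by
    intro X hX h1 Y h2
    refine Real.sqrt_le_sqrt ?_
    have h3 := mul_le_mul_of_nonneg_left (hS X hX Y) (by positivity : 0 ≤ M / 2)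
    calc _ ≤ _ := h3
      _ = 2 * (M / 2 * normSq θ X) * (M / 2 * normSq θ Y) := by ring
      _ = 2 := by rw [h1, h2]; norm_num
  have hop : ∀ X ∈ S, M / 2 * normSq θ X = 1 →
      operatorNorm (cartanInner (((M / 2 : ℝ) : ℂ) • killingForm ℂ L) θ) (fun Y => ⁅X, Y⁆) ≤ √2 := by
    intro X hX h1
    refine csSup_le ⟨_, Y₀, formLength_eq_one_iff.2 hY₁, rfl⟩ ?_
    rintro r ⟨Y, hY, rfl⟩
    rw [formLength_cartanInner]
    exact hb X hX h1 Y (formLength_eq_one_iff.1 hY)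
  have hop₀ : √2 ≤ operatorNorm (cartanInner (((M / 2 : ℝ) : ℂ) • killingForm ℂ L) θ)
      (fun Y => ⁅X₀, Y⁆) := by
    refine le_csSup ⟨√2, ?_⟩ ⟨Y₀, formLength_eq_one_iff.2 hY₁, ?_⟩
    · rintro r ⟨Y, hY, rfl⟩
      rw [formLength_cartanInner]
      exact hb X₀ hX₀ hX₁ Y (formLength_eq_one_iff.1 hY)
    · rw [formLength_cartanInner, h0]
  have hmem : operatorNorm (cartanInner (((M / 2 : ℝ) : ℂ) • killingForm ℂ L) θ)
      (fun Y => ⁅X₀, Y⁆) ∈ {r : ℝ | ∃ X ∈ S,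
        formLength (cartanInner (((M / 2 : ℝ) : ℂ) • killingForm ℂ L) θ) X = 1 ∧
        r = operatorNorm (cartanInner (((M / 2 : ℝ) : ℂ) • killingForm ℂ L) θ)
          (fun Y => ⁅X, Y⁆)} := ⟨X₀, hX₀, formLength_eq_one_iff.2 hX₁, rfl⟩
  have hub : ∀ r ∈ {r : ℝ | ∃ X ∈ S,
        formLength (cartanInner (((M / 2 : ℝ) : ℂ) • killingForm ℂ L) θ) X = 1 ∧
        r = operatorNorm (cartanInner (((M / 2 : ℝ) : ℂ) • killingForm ℂ L) θ)
          (fun Y => ⁅X, Y⁆)}, r ≤ √2 := by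
    rintro r ⟨X, hX, h1, rfl⟩
    exact hop X hX (formLength_eq_one_iff.1 h1)
  exact le_antisymm (csSup_le ⟨_, hmem⟩ hub) (hop₀.trans (le_csSup ⟨_, hub⟩ hmem))

end IsCompactConjugation
end CompactConjugation

/-! ### The extremal vectors. -/

section CompactConjugation

open LieAlgebra LieModule LieAlgebra.IsKilling ComplexConjugate

variable {L : Type*} [LieRing L] [LieAlgebra ℂ L] [FiniteDimensional ℂ L]

namespace IsCompactConjugation

variable {θ : L → L} (hθ : IsCompactConjugation θ)

include hθ

omit [FiniteDimensional ℂ L] in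
lemma normSq_map (X : L) : normSq θ (θ X) = normSq θ X := by
  rw [normSq, hθ.killingForm_map, Complex.conj_re, normSq]

variable [IsKilling ℂ L] {𝔥 : LieSubalgebra ℂ L} [𝔥.IsCartanSubalgebra]
  (hs : ∀ h ∈ 𝔥, θ h ∈ 𝔥) {μ : Weight ℂ 𝔥 L} (hμ : μ.IsNonZero)

omit [IsKilling ℂ L] in
-- The cross terms are multiples of `κ(X, X)` and its conjugate, which vanish because `2μ ≠ 0`.
include hμ in
lemma normSq_add_smul_map {X : L} (hX : X ∈ rootSpace 𝔥 μ) (e : ℂ) :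
    normSq θ (X + e • θ X) = (1 + Complex.normSq e) * normSq θ X := by
  have h0 : killingForm ℂ L X X = 0 :=
    killingForm_apply_eq_zero_of_mem_rootSpace_of_add_ne_zero ℂ L 𝔥 hX hX fun h => hμ <| by
      ext z
      have := congrFun h z
      simp only [Pi.add_apply, Pi.zero_apply] at this ⊢
      linear_combination this / 2
  have h1 : killingForm ℂ L (θ X) (θ X) = 0 := by rw [hθ.killingForm_map, h0, _root_.map_zero]
  have h2 : normSq θ (X + e • θ X) = normSq θ X + normSq θ (e • θ X) := by
    simp only [normSq, hθ.map_add, hθ.map_smul, hθ.involutive, _root_.map_add, _root_.map_smul,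
      LinearMap.add_apply, LinearMap.smul_apply, h0, h1, smul_zero, add_zero, zero_add,
      Complex.add_re]
    ring
  rw [h2, hθ.normSq_smul, hθ.normSq_map]
  ring

lemma killingForm_lie_map {X Y : L} {t : 𝔥} (h : IsWeylChevalleyPair θ 𝔥 μ t X Y) :
    (normSq θ X : ℂ) • rootVec μ = t := by
  obtain ⟨hX, hY, hXY, hθX⟩ := h
  have hY' : Y = -θ X := by rw [hθX, neg_neg]
  have h1 := lie_eq_killingForm_smul_of_mem_rootSpace_of_mem_rootSpace_neg hX hY
  rw [hXY, hY', _root_.map_neg, hθ.killingForm_self, neg_neg] at h1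
  exact (Subtype.ext h1).symm

include hs in
lemma exists_isWeylChevalleyPair {r : ℝ} (hr : 0 < r) :
    ∃ X Y, IsWeylChevalleyPair θ 𝔥 μ ((r : ℂ) • rootVec μ) X Y := by
  obtain ⟨v, hv, hv0⟩ := μ.exists_ne_zero
  -- Since `[X, -θ X] = normSq X · t_μ`, a root vector only has to be rescaled to squared norm `r`.
  have hv1 := hθ.normSq_pos hv0
  set a : ℂ := ((√(r / normSq θ v) : ℝ) : ℂ)
  have hX : a • v ∈ rootSpace 𝔥 μ := (rootSpace 𝔥 μ).smul_mem a hv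
  have hY : -θ (a • v) ∈ rootSpace 𝔥 (-μ : 𝔥 → ℂ) :=
    (rootSpace 𝔥 (-μ : 𝔥 → ℂ)).neg_mem (hθ.map_mem_rootSpace hs hX)
  refine ⟨a • v, -θ (a • v), hX, hY, ?_, by rw [neg_neg]⟩
  have h1 := lie_eq_killingForm_smul_of_mem_rootSpace_of_mem_rootSpace_neg hX hY
  rw [h1, _root_.map_neg, hθ.killingForm_self, neg_neg, hθ.normSq_smul, Complex.normSq_ofReal,
    Real.mul_self_sqrt (by positivity), div_mul_cancel₀ _ hv1.ne']
  rfl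

end IsCompactConjugation

open IsCompactConjugation

/-- The vectors `H = H_μ / √2` and `Z = (i / √2) (X_μ + X_{-μ})`. -/
lemma IsCompactConjugation.norm_root_vectors [IsKilling ℂ L] {θ : L → L}
    (hθ : IsCompactConjugation θ)
    {𝔥 : LieSubalgebra ℂ L} [𝔥.IsCartanSubalgebra] (hs : ∀ h ∈ 𝔥, θ h ∈ 𝔥)
    {μ : Weight ℂ 𝔥 L} (hμ : μ.IsNonZero) {t : 𝔥}
    (ht : ((normSq θ (rootVec μ : L) / 2 : ℝ) : ℂ) • t = rootVec μ) {X Y : L}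
    (h : IsWeylChevalleyPair θ 𝔥 μ t X Y) {H Z : L} (hH : H = ((√2 : ℝ) : ℂ)⁻¹ • (t : L))
    (hZ : Z = (Complex.I / ((√2 : ℝ) : ℂ)) • (X + Y)) :
    θ H = -H ∧ normSq θ (rootVec μ : L) / 2 * normSq θ H = 1 ∧
      normSq θ (rootVec μ : L) / 2 * normSq θ Z = 1 ∧
      normSq θ (rootVec μ : L) / 2 * normSq θ ⁅H, Z⁆ = 2 := by
  have hM := hθ.normSq_rootVec_pos hμ
  set M := normSq θ (rootVec μ : L) with hMdef
  have hM0 : (M : ℂ) ≠ 0 := by exact_mod_cast hM.ne'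
  have ht' : (t : L) = ((2 / M : ℝ) : ℂ) • (rootVec μ : L) := by
    rw [← ht]
    change _ = ((2 / M : ℝ) : ℂ) • ((M / 2 : ℝ) : ℂ) • (t : L)
    rw [smul_smul, ← Complex.ofReal_mul, div_mul_div_cancel₀ hM.ne']
    simp
  have hθt : θ (t : L) = -t := by
    rw [ht', hθ.map_smul, Complex.conj_ofReal, hθ.map_rootVec hs, smul_neg]
  have hμt : μ t = 2 := by
    have e : t = ((2 / M : ℝ) : ℂ) • rootVec μ := Subtype.ext ht'
    rw [e, ← Weight.toLinear_apply, _root_.map_smul, Weight.toLinear_apply,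
      hθ.apply_rootVec_self hs, smul_eq_mul, ← hMdef, ← Complex.ofReal_mul,
      div_mul_cancel₀ _ hM.ne']
    norm_num
  -- Apply `μ` to `normSq X · t_μ = H_μ`, using `μ(t_μ) = M` and `μ(H_μ) = 2`.
  have hnX : M / 2 * normSq θ X = 1 := by
    have h1 := hθ.killingForm_lie_map h
    have h2 := congrArg (fun z => Weight.toLinear ℂ 𝔥 L μ z) h1
    simp only [_root_.map_smul, Weight.toLinear_apply, smul_eq_mul, hμt,
      hθ.apply_rootVec_self hs, ← hMdef] at h2
    have h3 : normSq θ X * M = 2 := by exact_mod_cast h2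
    linarith
  have hnt : normSq θ (t : L) = 4 / M := by
    rw [ht', hθ.normSq_smul, Complex.normSq_ofReal, ← hMdef]
    field_simp
    norm_num
  obtain ⟨hX, hY, hXY, hθX⟩ := h
  have hY' : Y = -θ X := by rw [hθX, neg_neg]
  have hsq : (((√2 : ℝ) : ℂ)⁻¹) * ((√2 : ℝ) : ℂ)⁻¹ = 1 / 2 := by
    rw [← mul_inv, ← Complex.ofReal_mul, Real.mul_self_sqrt (by norm_num)]
    norm_num
  have hns : Complex.normSq (((√2 : ℝ) : ℂ)⁻¹) = 1 / 2 := by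
    rw [Complex.normSq_inv, Complex.normSq_ofReal, Real.mul_self_sqrt (by norm_num)]
    norm_num
  refine ⟨?_, ?_, ?_, ?_⟩
  · rw [hH, hθ.map_smul, hθt, ← Complex.ofReal_inv, Complex.conj_ofReal, smul_neg]
  · rw [hH, hθ.normSq_smul, hns, hnt]
    field_simp
    norm_num
  · have h1 := hθ.normSq_add_smul_map hμ hX (-1)
    rw [neg_one_smul, ← hY'] at h1
    rw [hZ, hθ.normSq_smul, h1, div_eq_mul_inv Complex.I, Complex.normSq_mul, hns]
    simp only [Complex.normSq_I, Complex.normSq_neg, Complex.normSq_one]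
    linarith
  -- Here `Z` is `i/√2` times `X - θ X`, and `ad H` has eigenvalues `√2` and `-√2` on the two terms.
  · have h1 : ⁅H, Z⁆ = Complex.I • (X + (1 : ℂ) • θ X) := by
      have e1 := lie_rootSpace hX t.2
      have e2 := lie_rootSpace hY t.2
      change ⁅(t : L), X⁆ = μ t • X at e1
      change ⁅(t : L), Y⁆ = (-(μ t)) • Y at e2
      rw [hH, hZ, smul_lie, lie_smul, lie_add, e1, e2, hμt, hY', smul_smul, div_eq_mul_inv,
        mul_comm Complex.I, ← mul_assoc, hsq, neg_smul, smul_neg, neg_neg, ← smul_add, smul_smul,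
        one_smul]
      congr 1
      ring
    rw [h1, hθ.normSq_smul, hθ.normSq_add_smul_map hμ hX]
    simp only [Complex.normSq_I, Complex.normSq_one]
    linarith

theorem IsCompactConjugation.renormalizedKillingForm [IsSimple ℂ L] {θ : L → L} (hθ : IsCompactConjugation θ) :
    (∃! B : LinearMap.BilinForm ℂ L, IsRenormalizedKillingForm θ B) ∧
    ∀ B : LinearMap.BilinForm ℂ L, IsRenormalizedKillingForm θ B →
      (∀ X Y, cartanInner B θ X Y = cartanInner B θ Y X) ∧
      (∀ X, X ≠ 0 → 0 < cartanInner B θ X X) ∧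
      wangC1 (cartanInner B θ) θ = √2 ∧ wangC2 (cartanInner B θ) θ = √2 ∧
      ∀ (𝔥 : LieSubalgebra ℂ L) [𝔥.IsCartanSubalgebra] (μ : LieModule.Weight ℂ 𝔥 L) (t : 𝔥),
        (∀ h ∈ 𝔥, θ h ∈ 𝔥) → IsMaximalRoot 𝔥 μ → IsDualVector B 𝔥 μ t →
        (∃ X Y, IsWeylChevalleyPair θ 𝔥 μ t X Y) ∧
        ∀ X Y, IsWeylChevalleyPair θ 𝔥 μ t X Y → ∀ H Z : L,
          H = ((√2 : ℝ) : ℂ)⁻¹ • (t : L) → Z = (Complex.I / ((√2 : ℝ) : ℂ)) • (X + Y) →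
          θ H = -H ∧ formLength (cartanInner B θ) H = 1 ∧
          θ (Complex.I • H) = Complex.I • H ∧
          formLength (cartanInner B θ) (Complex.I • H) = 1 ∧
          formLength (cartanInner B θ) Z = 1 ∧
          formLength (cartanInner B θ) ⁅H, Z⁆ = √2 ∧
          formLength (cartanInner B θ) ⁅Complex.I • H, Z⁆ = √2 := by
  have := hθ.isKilling
  obtain ⟨𝔥₀, _, μ₀, hs₀, hμ₀⟩ := hθ.exists_isMaximalRoot
  refine ⟨⟨_, (hθ.isRenormalizedKillingForm_iff hs₀ hμ₀).2 rfl,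
    fun B hB => (hθ.isRenormalizedKillingForm_iff hs₀ hμ₀).1 hB⟩, fun B hB => ?_⟩
  have hsymm : ∀ X Y, cartanInner B θ X Y = cartanInner B θ Y X := by
    intro X Y
    rw [(hθ.isRenormalizedKillingForm_iff hs₀ hμ₀).1 hB]
    simp only [cartanInner, LinearMap.smul_apply, smul_eq_mul, Complex.re_ofReal_mul]
    rw [← Complex.conj_re, ← hθ.killingForm_map, hθ.involutive, LieModule.traceForm_comm]
  have hpos : ∀ X, X ≠ 0 → 0 < cartanInner B θ X X := by
    intro X hX
    rw [(hθ.isRenormalizedKillingForm_iff hs₀ hμ₀).1 hB]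
    simp only [cartanInner, LinearMap.smul_apply, smul_eq_mul, Complex.re_ofReal_mul, ← mul_neg]
    exact mul_pos (half_pos (hθ.normSq_rootVec_pos hμ₀.1)) (hθ.normSq_pos hX)
  have hI : ∀ H : L, θ H = -H → θ (Complex.I • H) = Complex.I • H := by
    intro H hH
    rw [hθ.map_smul, hH, Complex.conj_I, neg_smul, smul_neg, neg_neg]
  have hnI : ∀ X : L, normSq θ (Complex.I • X) = normSq θ X := by
    intro X
    rw [hθ.normSq_smul, Complex.normSq_I, one_mul]
  have hM₀ := hθ.normSq_rootVec_pos hμ₀.1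
  have ht₀ : ((normSq θ (rootVec μ₀ : L) / 2 : ℝ) : ℂ) •
      (((2 / normSq θ (rootVec μ₀ : L) : ℝ) : ℂ) • rootVec μ₀) = rootVec μ₀ := by
    rw [smul_smul, ← Complex.ofReal_mul, div_mul_div_cancel₀ (by norm_num), div_self hM₀.ne']
    simp
  obtain ⟨X₀, Y₀, hXY₀⟩ := hθ.exists_isWeylChevalleyPair hs₀
    (div_pos two_pos hM₀)
  obtain ⟨h1, h2, h3, h4⟩ := hθ.norm_root_vectors hs₀ hμ₀.1 ht₀ hXY₀ rfl rfl
  refine ⟨hsymm, hpos, ?_, ?_, ?_⟩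
  · rw [(hθ.isRenormalizedKillingForm_iff hs₀ hμ₀).1 hB]
    exact wangConstant_eq hM₀ (fun X hX Y => hθ.normSq_lie_le_of_map_eq_neg hs₀ hμ₀ hX Y)
      h1 h2 h3 h4
  · rw [(hθ.isRenormalizedKillingForm_iff hs₀ hμ₀).1 hB]
    exact wangConstant_eq hM₀ (fun X hX Y => hθ.normSq_lie_le_of_map_eq hs₀ hμ₀ hX Y)
      (hI _ h1) (by rwa [hnI]) h3 (by rwa [smul_lie, hnI])
  · intro 𝔥 _ μ t hs hμ ht
    have hB' := (hθ.isRenormalizedKillingForm_iff hs hμ).1 hB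
    subst hB'
    have ht' := smul_eq_rootVec ht
    have hM := hθ.normSq_rootVec_pos hμ.1
    have ht'' : ((2 / normSq θ (rootVec μ : L) : ℝ) : ℂ) • rootVec μ = t := by
      have h1 := congrArg (((2 / normSq θ (rootVec μ : L) : ℝ) : ℂ) • ·) ht'
      rw [smul_smul, ← Complex.ofReal_mul, div_mul_div_cancel₀ hM.ne',
        div_self two_ne_zero, Complex.ofReal_one, one_smul] at h1
      exact h1.symm
    refine ⟨?_, fun X Y hXY H Z hH hZ => ?_⟩
    · obtain ⟨X, Y, hXY⟩ := hθ.exists_isWeylChevalleyPair hs (div_pos two_pos hM)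
      refine ⟨X, Y, ?_⟩
      rwa [ht''] at hXY
    · obtain ⟨h1, h2, h3, h4⟩ := hθ.norm_root_vectors hs hμ.1 ht' hXY hH hZ
      simp only [smul_lie, formLength_cartanInner, hnI, h2, h3, h4, Real.sqrt_one, true_and]
      exact ⟨h1, hI H h1, trivial⟩

end CompactConjugation

/-! ### Negativity of the trace form on skew maps. -/

section SkewTrace

/-- The trace of the square of a nonzero skew endomorphism is negative. -/
lemma trace_mul_self_neg_of_skew {V : Type*} [AddCommGroup V] [Module ℝ V] [FiniteDimensional ℝ V]
    (b : LinearMap.BilinForm ℝ V) (hs : ∀ v w, b v w = b w v) (hp : ∀ v, v ≠ 0 → 0 < b v v)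
    {T : V →ₗ[ℝ] V} (hT : ∀ v w, b (T v) w + b v (T w) = 0) (hT0 : T ≠ 0) :
    LinearMap.trace ℝ V (T * T) < 0 := by
  let c : InnerProductSpace.Core ℝ V :=
    { inner := fun v w => b v w
      conj_inner_symm := fun v w => hs w v
      re_inner_nonneg := fun v => by
        by_cases hv : v = 0
        · simp [hv]
        · exact (hp v hv).le
      add_left := fun u v w => by simp
      smul_left := fun u v r => by simp
      definite := fun v hv => by
        by_contra h
        exact (hp v h).ne' hv }
  let _ : NormedAddCommGroup V := c.toNormedAddCommGroup
  let _ : InnerProductSpace ℝ V := InnerProductSpace.ofCore c.toCore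
  let e := stdOrthonormalBasis ℝ V
  have h1 : ∀ i, inner ℝ (e i) ((T * T) (e i)) = -inner ℝ (T (e i)) (T (e i)) := fun i =>
    eq_neg_of_add_eq_zero_right (hT (e i) (T (e i)))
  rw [LinearMap.trace_eq_sum_inner _ e, Finset.sum_congr rfl fun i _ => h1 i,
    Finset.sum_neg_distrib, neg_lt_zero]
  obtain ⟨i, hi⟩ : ∃ i, T (e i) ≠ 0 := by
    by_contra! h
    exact hT0 (e.toBasis.ext fun i => by simpa using h i)
  exact Finset.sum_pos' (fun i _ => real_inner_self_nonneg)
    ⟨i, Finset.mem_univ i, real_inner_self_pos.2 hi⟩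

end SkewTrace

/-! ### From the compact real form to its complexification. -/

section Complexification

open LieAlgebra LieModule ComplexConjugate

variable {𝔨 : Type*} [LieRing 𝔨] [LieAlgebra ℝ 𝔨]

/-- Each `ad x` is skew for `b`, and it is nonzero because a simple algebra has trivial center. -/
lemma killingForm_self_neg_of_skew [FiniteDimensional ℝ 𝔨] [IsSimple ℝ 𝔨]
    (b : LinearMap.BilinForm ℝ 𝔨) (hs : ∀ v w, b v w = b w v) (hp : ∀ v, v ≠ 0 → 0 < b v v)
    (hb : ∀ u v w : 𝔨, b ⁅u, v⁆ w + b v ⁅u, w⁆ = 0) {x : 𝔨} (hx : x ≠ 0) :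
    killingForm ℝ 𝔨 x x < 0 := by
  refine trace_mul_self_neg_of_skew b hs hp (hb x) fun h => hx ?_
  have h1 : x ∈ center ℝ 𝔨 := fun y => by
    rw [← lie_skew, neg_eq_zero]
    exact LinearMap.congr_fun h y
  rwa [center_eq_bot, LieSubmodule.mem_bot] at h1

lemma isKilling_of_killingForm_self_neg (h : ∀ x : 𝔨, x ≠ 0 → killingForm ℝ 𝔨 x x < 0) :
    IsKilling ℝ 𝔨 := by
  refine ⟨(LieSubmodule.eq_bot_iff _).2 fun x hx => ?_⟩
  by_contra hx0
  rw [LieIdeal.mem_killingCompl] at hx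
  exact (h x hx0).ne (hx x (LieSubmodule.mem_top x))

/-- Some Engel subalgebra is a Cartan subalgebra, hence abelian as the Killing form is
nondegenerate; it contains the centralizer of its element. -/
lemma exists_abelian_centralizer [FiniteDimensional ℝ 𝔨] [IsKilling ℝ 𝔨] :
    ∃ x : 𝔨, ∀ y z : 𝔨, ⁅x, y⁆ = 0 → ⁅x, z⁆ = 0 → ⁅y, z⁆ = 0 := by
  obtain ⟨x, hx⟩ := exists_isCartanSubalgebra_engel ℝ 𝔨
  have hab : IsLieAbelian (LieSubalgebra.engel ℝ x) := inferInstance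
  have h : ∀ y : 𝔨, ⁅x, y⁆ = 0 → y ∈ LieSubalgebra.engel ℝ x := fun y hy =>
    (LieSubalgebra.mem_engel_iff ℝ x y).2 ⟨1, by simpa using hy⟩
  exact ⟨x, fun y z hy hz => congrArg Subtype.val (hab.trivial ⟨y, h y hy⟩ ⟨z, h z hz⟩)⟩

variable (𝔨) in
/-- The conjugation of `ℂ ⊗ 𝔨`. -/
def tensorConj : ℂ ⊗[ℝ] 𝔨 →ₗ[ℝ] ℂ ⊗[ℝ] 𝔨 :=
  LinearMap.rTensor 𝔨 Complex.conjAe.toLinearMap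

lemma tensorConj_tmul (c : ℂ) (x : 𝔨) : tensorConj 𝔨 (c ⊗ₜ x) = conj c ⊗ₜ[ℝ] x := rfl

lemma tensorConj_smul (c : ℂ) (Z : ℂ ⊗[ℝ] 𝔨) :
    tensorConj 𝔨 (c • Z) = conj c • tensorConj 𝔨 Z := by
  induction Z using TensorProduct.induction_on with
  | zero => simp
  | tmul z x => simp [tensorConj_tmul, TensorProduct.smul_tmul']
  | add X Y hX hY => simp only [smul_add, map_add, hX, hY]

lemma tensorConj_lie (X Y : ℂ ⊗[ℝ] 𝔨) :
    tensorConj 𝔨 ⁅X, Y⁆ = ⁅tensorConj 𝔨 X, tensorConj 𝔨 Y⁆ :=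
  (ExtendScalars.map (Complex.conjAe : ℂ →ₐ[ℝ] ℂ) (LieHom.id : 𝔨 →ₗ⁅ℝ⁆ 𝔨)).map_lie X Y

lemma tensorConj_tensorConj (Z : ℂ ⊗[ℝ] 𝔨) : tensorConj 𝔨 (tensorConj 𝔨 Z) = Z := by
  induction Z using TensorProduct.induction_on with
  | zero => simp
  | tmul z x => simp [tensorConj_tmul]
  | add X Y hX hY => simp only [map_add, hX, hY]

lemma exists_eq_add_I_smul (Z : ℂ ⊗[ℝ] 𝔨) :
    ∃ x y : 𝔨, Z = (1 : ℂ) ⊗ₜ[ℝ] x + Complex.I • ((1 : ℂ) ⊗ₜ[ℝ] y) := by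
  induction Z using TensorProduct.induction_on with
  | zero => exact ⟨0, 0, by simp⟩
  | tmul z x =>
    refine ⟨z.re • x, z.im • x, ?_⟩
    rw [TensorProduct.tmul_smul, TensorProduct.tmul_smul, TensorProduct.smul_tmul',
      TensorProduct.smul_tmul', TensorProduct.smul_tmul', ← TensorProduct.add_tmul]
    congr 1
    conv_lhs => rw [← Complex.re_add_im z]
    simp [mul_comm]
  | add X Y hX hY =>
    obtain ⟨x, y, rfl⟩ := hX
    obtain ⟨x', y', rfl⟩ := hY
    refine ⟨x + x', y + y', ?_⟩
    simp only [TensorProduct.tmul_add, smul_add]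
    abel

lemma tensorConj_add_I_smul (x y : 𝔨) :
    tensorConj 𝔨 ((1 : ℂ) ⊗ₜ[ℝ] x + Complex.I • ((1 : ℂ) ⊗ₜ[ℝ] y)) =
      (1 : ℂ) ⊗ₜ[ℝ] x + (-Complex.I) • ((1 : ℂ) ⊗ₜ[ℝ] y) := by
  simp [tensorConj_smul, tensorConj_tmul]

lemma exists_eq_one_tmul {Z : ℂ ⊗[ℝ] 𝔨} (hZ : tensorConj 𝔨 Z = Z) :
    ∃ x : 𝔨, Z = (1 : ℂ) ⊗ₜ[ℝ] x := by
  obtain ⟨x, y, rfl⟩ := exists_eq_add_I_smul Z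
  refine ⟨x, ?_⟩
  rw [tensorConj_add_I_smul, neg_smul] at hZ
  have h := add_left_cancel hZ
  rw [eq_comm, ← sub_eq_zero, sub_neg_eq_add, ← two_smul ℂ, smul_eq_zero] at h
  rw [h.resolve_left two_ne_zero, add_zero]

lemma one_tmul_injective : Function.Injective fun x : 𝔨 => (1 : ℂ) ⊗ₜ[ℝ] x :=
  Module.FaithfullyFlat.tensorProduct_mk_injective (A := ℝ) (B := ℂ) 𝔨

lemma one_tmul_add_I_smul_eq_zero {x y : 𝔨}
    (h : (1 : ℂ) ⊗ₜ[ℝ] x + Complex.I • ((1 : ℂ) ⊗ₜ[ℝ] y) = 0) : x = 0 ∧ y = 0 := by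
  have h1 := congrArg (tensorConj 𝔨) h
  rw [tensorConj_add_I_smul, map_zero, neg_smul] at h1
  have h2 : (1 : ℂ) ⊗ₜ[ℝ] x = 0 := by
    have h3 : (2 : ℂ) • ((1 : ℂ) ⊗ₜ[ℝ] x) = 0 := by
      rw [two_smul]
      calc _ = ((1 : ℂ) ⊗ₜ[ℝ] x + Complex.I • ((1 : ℂ) ⊗ₜ[ℝ] y)) +
            ((1 : ℂ) ⊗ₜ[ℝ] x + -(Complex.I • ((1 : ℂ) ⊗ₜ[ℝ] y))) := by abel
        _ = 0 := by rw [h, h1, add_zero]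
    simpa using h3
  rw [h2, zero_add] at h
  have h4 : (1 : ℂ) ⊗ₜ[ℝ] y = 0 := by simpa using h
  exact ⟨one_tmul_injective (by simpa using h2), one_tmul_injective (by simpa using h4)⟩

lemma ad_one_tmul (x y : 𝔨) :
    ad ℂ (ℂ ⊗[ℝ] 𝔨) ((1 : ℂ) ⊗ₜ[ℝ] x) ((1 : ℂ) ⊗ₜ[ℝ] y) = (1 : ℂ) ⊗ₜ[ℝ] ⁅x, y⁆ := by
  refine (ExtendScalars.bracket_tmul ℝ ℂ 𝔨 𝔨 1 1 x y).trans ?_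
  rw [mul_one]

lemma killingForm_one_tmul [FiniteDimensional ℝ 𝔨] (x y : 𝔨) :
    killingForm ℂ (ℂ ⊗[ℝ] 𝔨) ((1 : ℂ) ⊗ₜ[ℝ] x) ((1 : ℂ) ⊗ₜ[ℝ] y) = (killingForm ℝ 𝔨 x y : ℂ) := by
  rw [killingForm, traceForm_baseChange, LinearMap.BilinForm.baseChange_tmul]
  simp

/-- The extension of scalars of an automorphism. -/
def tensorLieEquiv (φ : 𝔨 ≃ₗ⁅ℝ⁆ 𝔨) : (ℂ ⊗[ℝ] 𝔨) ≃ₗ⁅ℂ⁆ (ℂ ⊗[ℝ] 𝔨) :=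
  { LinearEquiv.baseChange ℝ ℂ 𝔨 𝔨 φ.toLinearEquiv with
    map_lie' := fun {X Y} =>
      (ExtendScalars.map (AlgHom.id ℝ ℂ) (φ : 𝔨 →ₗ⁅ℝ⁆ 𝔨)).map_lie X Y }

lemma tensorLieEquiv_tmul (φ : 𝔨 ≃ₗ⁅ℝ⁆ 𝔨) (c : ℂ) (x : 𝔨) :
    tensorLieEquiv φ (c ⊗ₜ x) = c ⊗ₜ[ℝ] φ x := rfl

lemma tensorLieEquiv_tensorConj (φ : 𝔨 ≃ₗ⁅ℝ⁆ 𝔨) (Z : ℂ ⊗[ℝ] 𝔨) :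
    tensorLieEquiv φ (tensorConj 𝔨 Z) = tensorConj 𝔨 (tensorLieEquiv φ Z) := by
  induction Z using TensorProduct.induction_on with
  | zero => simp
  | tmul z x => simp only [tensorConj_tmul, tensorLieEquiv_tmul]
  | add X Y hX hY => simp only [map_add, hX, hY]

lemma isCompactConjugation_tensorConj [FiniteDimensional ℝ 𝔨]
    (hneg : ∀ x : 𝔨, x ≠ 0 → killingForm ℝ 𝔨 x x < 0)
    (hconj : ∀ (l : 𝔨 →ₗ[ℝ] ℝ) (w : 𝔨), ∃ φ : 𝔨 ≃ₗ⁅ℝ⁆ 𝔨, ∀ v : 𝔨, l ⁅v, φ w⁆ = 0) :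
    IsCompactConjugation (tensorConj 𝔨) where
  map_add := map_add _
  map_smul := tensorConj_smul
  map_lie := tensorConj_lie
  involutive := tensorConj_tensorConj
  killingForm_map X Y := by
    obtain ⟨x, y, rfl⟩ := exists_eq_add_I_smul X
    obtain ⟨x', y', rfl⟩ := exists_eq_add_I_smul Y
    rw [tensorConj_add_I_smul, tensorConj_add_I_smul]
    simp only [map_add, map_smul, LinearMap.add_apply, LinearMap.smul_apply,
      killingForm_one_tmul, smul_eq_mul, map_mul, Complex.conj_I, Complex.conj_ofReal]
  pos X hX := by
    obtain ⟨x, y, rfl⟩ := exists_eq_add_I_smul X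
    have h : killingForm ℂ (ℂ ⊗[ℝ] 𝔨) ((1 : ℂ) ⊗ₜ[ℝ] x + Complex.I • ((1 : ℂ) ⊗ₜ[ℝ] y))
        (tensorConj 𝔨 ((1 : ℂ) ⊗ₜ[ℝ] x + Complex.I • ((1 : ℂ) ⊗ₜ[ℝ] y))) =
        ((killingForm ℝ 𝔨 x x + killingForm ℝ 𝔨 y y : ℝ) : ℂ) := by
      rw [tensorConj_add_I_smul]
      simp only [map_add, map_smul, LinearMap.add_apply, LinearMap.smul_apply, killingForm_one_tmul, smul_eq_mul, Complex.ofReal_add]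
      rw [show killingForm ℝ 𝔨 y x = killingForm ℝ 𝔨 x y from traceForm_comm ℝ 𝔨 𝔨 y x]
      linear_combination -(killingForm ℝ 𝔨 y y : ℂ) * Complex.I_mul_I
    have hle : ∀ z : 𝔨, killingForm ℝ 𝔨 z z ≤ 0 := fun z => by
      by_cases hz : z = 0
      · simp [hz]
      · exact (hneg z hz).le
    rw [h, Complex.ofReal_re, neg_pos]
    by_cases hx : x = 0
    · have hy : y ≠ 0 := by
        rintro rfl
        exact hX (by simp [hx])
      exact add_neg_of_nonpos_of_neg (hle x) (hneg y hy)
    · exact add_neg_of_neg_of_nonpos (hneg x hx) (hle y)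
  exists_conj a X ha hX := by
    obtain ⟨a, rfl⟩ := exists_eq_one_tmul ha
    obtain ⟨w, rfl⟩ := exists_eq_one_tmul hX
    -- With `l = κ(a, ·)`, criticality says that `[φ w, a]` is orthogonal to all of `𝔨`, in
    -- particular to itself.
    obtain ⟨φ, hφ⟩ := hconj (killingForm ℝ 𝔨 a) w
    refine ⟨tensorLieEquiv φ, tensorLieEquiv_tensorConj φ, ?_⟩
    rw [tensorLieEquiv_tmul, ExtendScalars.bracket_tmul]
    have h : ⁅φ w, a⁆ = 0 := by
      by_contra h
      refine (hneg _ h).ne ?_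
      rw [killingForm, ← traceForm_apply_lie_apply, traceForm_comm]
      exact hφ ⁅φ w, a⁆
    rw [h, TensorProduct.tmul_zero]
  exists_regular := by
    have := isKilling_of_killingForm_self_neg hneg
    obtain ⟨x, hx⟩ := exists_abelian_centralizer (𝔨 := 𝔨)
    have h : ∀ y z : 𝔨, ⁅(1 : ℂ) ⊗ₜ[ℝ] x, (1 : ℂ) ⊗ₜ[ℝ] y + Complex.I • ((1 : ℂ) ⊗ₜ[ℝ] z)⁆ = 0 →
        ⁅x, y⁆ = 0 ∧ ⁅x, z⁆ = 0 := fun y z h => by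
      change ad ℂ (ℂ ⊗[ℝ] 𝔨) _ _ = 0 at h
      rw [map_add, map_smul, ad_one_tmul, ad_one_tmul] at h
      exact one_tmul_add_I_smul_eq_zero h
    refine ⟨(1 : ℂ) ⊗ₜ[ℝ] x, by simp [tensorConj_tmul], fun Y Z hY hZ => ?_⟩
    obtain ⟨y, y', rfl⟩ := exists_eq_add_I_smul Y
    obtain ⟨z, z', rfl⟩ := exists_eq_add_I_smul Z
    obtain ⟨h1, h2⟩ := h y y' hY
    obtain ⟨h3, h4⟩ := h z z' hZ
    change ad ℂ (ℂ ⊗[ℝ] 𝔨) _ _ = 0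
    simp only [map_add, map_smul, LinearMap.add_apply, LinearMap.smul_apply, ad_one_tmul,
      hx _ _ h1 h3, hx _ _ h1 h4, hx _ _ h2 h3, hx _ _ h2 h4, TensorProduct.tmul_zero, smul_zero,
      add_zero]

/-- The complexification of a compact simple Lie algebra is simple. -/
lemma isSimple_tensor [IsSimple ℝ 𝔨] (hθ : IsCompactConjugation (tensorConj 𝔨)) :
    IsSimple ℂ (ℂ ⊗[ℝ] 𝔨) where
  non_abelian h := IsSimple.non_abelian (R := ℝ) (L := 𝔨) ⟨fun x y =>
    one_tmul_injective (by
      have := h.trivial ((1 : ℂ) ⊗ₜ[ℝ] x) ((1 : ℂ) ⊗ₜ[ℝ] y)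
      rw [ExtendScalars.bracket_tmul, mul_one] at this
      simpa using this)⟩
  eq_bot_or_eq_top I := by
    refine or_iff_not_imp_left.2 fun hI => ?_
    obtain ⟨X, hX, hX0⟩ := (Submodule.ne_bot_iff (I : Submodule ℂ (ℂ ⊗[ℝ] 𝔨))).1
      ((LieSubmodule.toSubmodule_eq_bot I).not.2 hI)
    -- The ideal meets its conjugate: otherwise `ad X ∘ ad (θ X)`, whose values lie in both, would
    -- be zero, contradicting `κ(X, θ X) ≠ 0`. The real or imaginary part of `W` then gives a
    -- nonzero vector of `𝔨` in `I`.
    obtain ⟨W, hW, hW', hW0⟩ : ∃ W, W ∈ I ∧ tensorConj 𝔨 W ∈ I ∧ W ≠ 0 := by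
      by_contra! h
      have h1 : ∀ Y : ℂ ⊗[ℝ] 𝔨, ⁅X, ⁅tensorConj 𝔨 X, Y⁆⁆ = 0 := fun Y => by
        refine h _ (lie_mem_left ℂ _ I _ _ hX) ?_
        rw [tensorConj_lie, tensorConj_lie, tensorConj_tensorConj]
        exact lie_mem_right ℂ _ I _ _ (lie_mem_left ℂ _ I _ _ hX)
      have h2 : killingForm ℂ (ℂ ⊗[ℝ] 𝔨) X (tensorConj 𝔨 X) = 0 := by
        rw [killingForm_apply_apply]
        have : ad ℂ (ℂ ⊗[ℝ] 𝔨) X ∘ₗ ad ℂ (ℂ ⊗[ℝ] 𝔨) (tensorConj 𝔨 X) = 0 := LinearMap.ext h1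
        rw [this, map_zero]
      exact (hθ.pos X hX0).ne' (by rw [h2]; simp)
    obtain ⟨x, hx, hx0⟩ : ∃ x : 𝔨, (1 : ℂ) ⊗ₜ[ℝ] x ∈ I ∧ x ≠ 0 := by
      obtain ⟨x, y, rfl⟩ := exists_eq_add_I_smul W
      rw [tensorConj_add_I_smul, neg_smul] at hW'
      have h1 : (1 : ℂ) ⊗ₜ[ℝ] x ∈ I := by
        have := I.smul_mem (2⁻¹ : ℂ) (I.add_mem hW hW')
        rwa [add_add_add_comm, add_neg_cancel, add_zero, ← two_smul ℂ, inv_smul_smul₀ two_ne_zero]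
          at this
      by_cases hx : x = 0
      · refine ⟨y, ?_, fun hy => hW0 (by simp [hx, hy])⟩
        rw [hx, TensorProduct.tmul_zero, zero_add] at hW
        have := I.smul_mem Complex.I⁻¹ hW
        rwa [inv_smul_smul₀ Complex.I_ne_zero] at this
      · exact ⟨x, h1, hx⟩
    let J : LieIdeal ℝ 𝔨 :=
      { carrier := {x | (1 : ℂ) ⊗ₜ[ℝ] x ∈ I}
        add_mem' := fun {x y} hx hy => by
          rw [Set.mem_ofPred_eq, TensorProduct.tmul_add]
          exact I.add_mem hx hy
        zero_mem' := by
          rw [Set.mem_ofPred_eq, TensorProduct.tmul_zero]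
          exact I.zero_mem
        smul_mem' := fun c x hx => by
          have := I.smul_mem (c : ℂ) hx
          rw [TensorProduct.smul_tmul'] at this
          rw [Set.mem_ofPred_eq, TensorProduct.tmul_smul, TensorProduct.smul_tmul']
          convert this using 2
          simp
        lie_mem := fun {x y} hy => by
          have := lie_mem_right ℂ _ I ((1 : ℂ) ⊗ₜ[ℝ] x) _ hy
          rwa [ExtendScalars.bracket_tmul, mul_one] at this }
    have hJ : J = ⊤ := (IsSimple.eq_bot_or_eq_top J).resolve_left fun h =>
      hx0 ((LieSubmodule.eq_bot_iff J).1 h x hx)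
    have hJ' : ∀ x : 𝔨, (1 : ℂ) ⊗ₜ[ℝ] x ∈ I := fun x =>
      (hJ ▸ LieSubmodule.mem_top x : x ∈ J)
    refine eq_top_iff.2 fun Z _ => ?_
    obtain ⟨x, y, rfl⟩ := exists_eq_add_I_smul Z
    exact I.add_mem (hJ' x) (I.smul_mem _ (hJ' y))

variable {T L : Type*} [LieRing T] [LieAlgebra ℂ T] [LieRing L] [LieAlgebra ℂ L]

lemma lieEquiv_map_zero (e : T ≃ₗ⁅ℂ⁆ L) : e 0 = 0 := e.toLinearEquiv.map_zero

lemma isSimple_of_lieEquiv [hT : IsSimple ℂ T] (e : T ≃ₗ⁅ℂ⁆ L) : IsSimple ℂ L where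
  non_abelian h := hT.non_abelian ⟨fun x y => e.injective (by
    change e ⁅x, y⁆ = e 0
    rw [LieEquiv.map_lie, h.trivial, lieEquiv_map_zero])⟩
  eq_bot_or_eq_top I := by
    rcases hT.eq_bot_or_eq_top (I.comap (e : T →ₗ⁅ℂ⁆ L)) with h | h
    · refine Or.inl ((LieSubmodule.eq_bot_iff I).2 fun x hx => ?_)
      have : e.symm x ∈ I.comap (e : T →ₗ⁅ℂ⁆ L) := by
        rw [LieIdeal.mem_comap]
        simpa using hx
      rw [h, LieSubmodule.mem_bot] at this
      exact e.symm.injective (this.trans (lieEquiv_map_zero e.symm).symm)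
    · refine Or.inr (eq_top_iff.2 fun x _ => ?_)
      have : e.symm x ∈ I.comap (e : T →ₗ⁅ℂ⁆ L) := h ▸ LieSubmodule.mem_top _
      rw [LieIdeal.mem_comap] at this
      simpa using this

lemma IsCompactConjugation.of_lieEquiv {σ : T → T} (hσ : IsCompactConjugation σ)
    (e : T ≃ₗ⁅ℂ⁆ L) : IsCompactConjugation fun Z => e (σ (e.symm Z)) where
  map_add X Y := by
    change e (σ (e.symm.toLinearEquiv (X + Y))) = _
    rw [_root_.map_add, hσ.map_add]
    exact e.toLinearEquiv.map_add _ _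
  map_smul c X := by
    change e (σ (e.symm.toLinearEquiv (c • X))) = _
    rw [_root_.map_smul, hσ.map_smul]
    exact e.toLinearEquiv.map_smul _ _
  map_lie X Y := by
    rw [LieEquiv.map_lie, hσ.map_lie, LieEquiv.map_lie]
  involutive X := by simp [hσ.involutive]
  killingForm_map X Y := by
    rw [killingForm_of_equiv_apply, hσ.killingForm_map, killingForm_of_equiv_apply]
  pos X hX := by
    have h := hσ.pos (e.symm X) fun h => hX (by simpa using congrArg e h)
    rwa [← killingForm_of_equiv_apply e, e.apply_symm_apply] at h
  exists_conj a X ha hX := by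
    obtain ⟨φ, h1, h2⟩ := hσ.exists_conj (e.symm a) (e.symm X)
      (by simpa using congrArg e.symm ha) (by simpa using congrArg e.symm hX)
    refine ⟨(e.symm.trans φ).trans e, fun Y => by simp [h1], ?_⟩
    have h3 := congrArg e h2
    rw [LieEquiv.map_lie, e.apply_symm_apply, lieEquiv_map_zero] at h3
    exact h3
  exists_regular := by
    obtain ⟨x, hx, h⟩ := hσ.exists_regular
    refine ⟨e x, by simp [hx], fun Y Z hY hZ => ?_⟩
    have h1 : ∀ Y, ⁅e x, Y⁆ = 0 → ⁅x, e.symm Y⁆ = 0 := fun Y hY => by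
      have h2 := congrArg e.symm hY
      rwa [LieEquiv.map_lie, e.symm_apply_apply, lieEquiv_map_zero] at h2
    have h3 := congrArg e (h _ _ (h1 Y hY) (h1 Z hZ))
    rwa [LieEquiv.map_lie, e.apply_symm_apply, e.apply_symm_apply, lieEquiv_map_zero] at h3

end Complexification

/-! ### Application to the Lie algebra of the compact group. -/

section Theorem

variable {E : Type*} [NormedAddCommGroup E] [NormedSpace ℝ E] [FiniteDimensional ℝ E]
  {K : Type*} [TopologicalSpace K] [ChartedSpace E K] [Group K] [LieGroup 𝓘(ℝ, E) ∞ K]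
  [CompactSpace K] [LieAlgebra.IsSimple ℝ (GroupLieAlgebra 𝓘(ℝ, E) K)]
  {F : Type*} [NormedAddCommGroup F] [NormedSpace ℂ F] [FiniteDimensional ℂ F]
  {G : Type*} [TopologicalSpace G] [ChartedSpace F G] [Group G] [LieGroup 𝓘(ℂ, F) ∞ G]

variable (E K) in
lemma isCompactConjugation_groupLieAlgebra :
    IsCompactConjugation (tensorConj (GroupLieAlgebra 𝓘(ℝ, E) K)) := by
  have : FiniteDimensional ℝ (GroupLieAlgebra 𝓘(ℝ, E) K) :=
    inferInstanceAs (FiniteDimensional ℝ E)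
  obtain ⟨b, hs, hp, hb⟩ := exists_skew_form E K
  exact isCompactConjugation_tensorConj (fun x hx => killingForm_self_neg_of_skew b hs hp hb hx)
    exists_lieEquiv_apply_lie_eq_zero

end Theorem

end

theorem proposition4p1
    {E : Type*} [NormedAddCommGroup E] [NormedSpace ℝ E] [FiniteDimensional ℝ E]
    {K : Type*} [TopologicalSpace K] [ChartedSpace E K] [Group K] [LieGroup 𝓘(ℝ, E) ∞ K]
    [CompactSpace K] [SimplyConnectedSpace K]
    [LieAlgebra.IsSimple ℝ (GroupLieAlgebra 𝓘(ℝ, E) K)]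
    {F : Type*} [NormedAddCommGroup F] [NormedSpace ℂ F] [FiniteDimensional ℂ F]
    {G : Type*} [TopologicalSpace G] [ChartedSpace F G] [Group G] [LieGroup 𝓘(ℂ, F) ∞ G]
    [SimplyConnectedSpace G]
    (D : LieComplexification E K F G) :
    -- the renormalized Killing form exists and is unique
    (∃! B : LinearMap.BilinForm ℂ (GroupLieAlgebra 𝓘(ℂ, F) G),
      IsRenormalizedKillingForm D.cartanInvolution B) ∧
    ∀ B : LinearMap.BilinForm ℂ (GroupLieAlgebra 𝓘(ℂ, F) G),
      IsRenormalizedKillingForm D.cartanInvolution B →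
      -- it induces an inner product on the Lie algebra of `G`
      (∀ X Y, cartanInner B D.cartanInvolution X Y = cartanInner B D.cartanInvolution Y X) ∧
      (∀ X, X ≠ 0 → 0 < cartanInner B D.cartanInvolution X X) ∧
      -- the values of the constants
      wangC1 (cartanInner B D.cartanInvolution) D.cartanInvolution = √2 ∧
      wangC2 (cartanInner B D.cartanInvolution) D.cartanInvolution = √2 ∧
      -- the suprema are attained at `H = H_μ / √2` and `i H`, with `Z = (i / √2) (X_μ + X_{-μ})`
      ∀ (𝔥 : LieSubalgebra ℂ (GroupLieAlgebra 𝓘(ℂ, F) G)) [𝔥.IsCartanSubalgebra]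
        (μ : LieModule.Weight ℂ 𝔥 (GroupLieAlgebra 𝓘(ℂ, F) G)) (t : 𝔥),
        (∀ h ∈ 𝔥, D.cartanInvolution h ∈ 𝔥) → IsMaximalRoot 𝔥 μ → IsDualVector B 𝔥 μ t →
        (∃ X Y, IsWeylChevalleyPair D.cartanInvolution 𝔥 μ t X Y) ∧
        ∀ X Y, IsWeylChevalleyPair D.cartanInvolution 𝔥 μ t X Y →
          ∀ H Z : GroupLieAlgebra 𝓘(ℂ, F) G,
            H = ((√2 : ℝ) : ℂ)⁻¹ • (t : GroupLieAlgebra 𝓘(ℂ, F) G) →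
            Z = (Complex.I / ((√2 : ℝ) : ℂ)) • (X + Y) →
            D.cartanInvolution H = -H ∧
            formLength (cartanInner B D.cartanInvolution) H = 1 ∧
            D.cartanInvolution (Complex.I • H) = Complex.I • H ∧
            formLength (cartanInner B D.cartanInvolution) (Complex.I • H) = 1 ∧
            formLength (cartanInner B D.cartanInvolution) Z = 1 ∧
            formLength (cartanInner B D.cartanInvolution) ⁅H, Z⁆ = √2 ∧
            formLength (cartanInner B D.cartanInvolution) ⁅Complex.I • H, Z⁆ = √2 := by
  have h := isCompactConjugation_groupLieAlgebra E K
  have : FiniteDimensional ℂ (GroupLieAlgebra 𝓘(ℂ, F) G) :=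
    inferInstanceAs (FiniteDimensional ℂ F)
  have := isSimple_tensor h
  have := isSimple_of_lieEquiv D.lieEquiv
  exact (h.of_lieEquiv D.lieEquiv).renormalizedKillingForm
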